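/- Let $\mathbb C_q=\mathbb C[q,q^{-1}]$. For indices $1\le i,j\le 5$ put $p(i)=0$ for $i\le 4$, $p(5)=1$ and $\pi(a_{ij})=p(i)+p(j) \bmod 2$. Let $\mathcal O(\mathrm{GL}_q(4|1))$ be the $\mathbb C_q$-algebra generated by $a_{ij}$ $(1\le i,j\le5)$, subject to $a_{ij}^2=0$ when $\pi(a_{ij})=1$ and the Manin relations $$a_{ij}a_{il}=(-1)^{\pi(a_{ij})\pi(a_{il})}q^{(-1)^{p(i)+1}}a_{il}a_{ij}\ (j<l),\qquad a_{ij}a_{kj}=(-1)^{\pi(a_{ij})\pi(a_{kj})}q^{(-1)^{p(j)+1}}a_{kj}a_{ij}\ (i<k),$$ $$a_{ij}a_{kl}=(-1)^{\pi(a_{ij})\pi(a_{kl})}a_{kl}a_{ij}\quad (i<k,\ j>l\ \text{ or }\ i>k,\ j<l),$$ $$a_{ij}a_{kl}-(-1)^{\pi(a_{ij})\pi(a_{kl})}a_{kl}a_{ij}=(-1)^{\pi(a_{ij})\pi(a_{kj})}(q^{-1}-q)\,a_{kj}a_{il}\quad (i<k,\ j<l),$$ with two-sided inverses adjoined to the quantum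 determinants of the two even diagonal blocks, namely to $\sum_{\sigma\in S_4}(-q^{-1})^{\ell(\sigma)}a_{1\sigma(1)}a_{2\sigma(2)}a_{3\sigma(3)}a_{4\sigma(4)}$ and to $a_{55}$. Let $\mathcal O_q(P^l)$ be its quotient by the two-sided ideal generated by $a_{13},a_{14},a_{15},a_{23},a_{24},a_{25}$ (the quantum lower parabolic supergroup, the stabilizer of the big cell). In $\mathcal O_q(P^l)$ put $D_{ij}=a_{i1}a_{j2}-q^{-1}a_{i2}a_{j1}$ for $i<j$. Then $D_{12}$ is invertible. Put $$x=\begin{pmatrix}a_{11}&a_{12}\\a_{21}&a_{22}\end{pmatrix},\quad y=\begin{pmatrix}y_{33}&y_{34}\\y_{43}&y_{44}\end{pmatrix}=\begin{pmatrix}a_{33}&a_{34}\\a_{43}&a_{44}\end{pmatrix},\quad \begin{pmatrix}t_{31}&t_{32}\\t_{41}&t_{42}\\ \tau_{51}&\tau_{52}\end{pmatrix}=\begin{pmatrix}-q^{-1}D_{23}D_{12}^{-1}&D_{13}D_{12}^{-1}\\-q^{-1}D_{24}D_{12}^{-1}&D_{14}D_{12}^{-1}\\-q^{-1}D_{25}D_{12}^{-1}&D_{15}D_{12}^{-1}\end{pmatrix}.$$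 Let $\mathcal O_q(P)=\mathbb C_q\langle x_{ij},y_{kl},t_{il},\tau_{5l}\rangle/\mathcal I_P$ be the algebra of the quantum super Poincaré group in the generators $x,y,t,\tau$, where $\mathcal I_P$ is the ideal of all relations that these elements satisfy in $\mathcal O_q(P^l)$; that is, $\mathcal O_q(P)$ is the $\mathbb C_q$-subalgebra of $\mathcal O_q(P^l)$ generated by them. **Theorem.** The monomials ordered according to $$\tau_{52}>\tau_{51}>t_{32}>t_{31}>t_{42}>t_{41}>x_{11}>x_{12}>x_{21}>x_{22}>y_{33}>y_{34}>y_{43}>y_{44},$$ that is, the products $$\tau_{52}^{e_1}\tau_{51}^{e_2}\,t_{32}^{e_3}t_{31}^{e_4}t_{42}^{e_5}t_{41}^{e_6}\,x_{11}^{e_7}x_{12}^{e_8}x_{21}^{e_9}x_{22}^{e_{10}}\,y_{33}^{e_{11}}y_{34}^{e_{12}}y_{43}^{e_{13}}y_{44}^{e_{14}}$$ with $e_1,e_2\in\{0,1\}$ and $e_3,\dots,e_{14}\in\mathbb Z_{\ge0}$, form a basis of $\mathcal O_q(P)$ over $\mathbb C_q$. In particular $\mathcal O_q(P)$ is a free $\mathbb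 C_q$-module. -/

import Mathlib

namespace QuantumPoincare

noncomputable section

/-- The ground ring `ℂ[q, q⁻¹]`. -/
abbrev Cq : Type := LaurentPolynomial ℂ

/-- The element `q ^ n` of the ground ring, for an integer `n`. -/
def qpow (n : ℤ) : Cq := LaurentPolynomial.T n

/-- Parity of an index. Indices are zero-based: `0, 1, 2, 3` are even and `4` is odd. -/
def par (i : Fin 5) : ℕ := if i = 4 then 1 else 0

/-- Parity of the matrix entry in row `i` and column `j`. -/
def parity (i j : Fin 5) : ℕ := (par i + par j) % 2

/-- The sign `(-1) ^ n` in the ground ring. -/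
def sgn (n : ℕ) : Cq := (-1) ^ n

/-- Generators of the quantum general linear supergroup: the 25 matrix entries, and formal inverses
of the quantum determinants of the two even diagonal blocks. -/
inductive Gen : Type
  | entry (i j : Fin 5) : Gen
  | invDetEven : Gen
  | invDetOdd : Gen

/-- The free algebra on these generators. -/
abbrev FreeGL : Type := FreeAlgebra Cq Gen

/-- The matrix entry `a_{ij}` in the free algebra. -/
def fa (i j : Fin 5) : FreeGL := FreeAlgebra.ι Cq (Gen.entry i j)

/-- The number of inversions of a permutation. -/
def inversions (σ : Equiv.Perm (Fin 4)) : ℕ :=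
  (Finset.univ.filter fun p : Fin 4 × Fin 4 => p.1 < p.2 ∧ σ p.2 < σ p.1).card

/-- The quantum determinant of the upper left `4 × 4` block,
`∑_σ (-q⁻¹)^{ℓ(σ)} a_{1σ(1)} a_{2σ(2)} a_{3σ(3)} a_{4σ(4)}`. The quantum determinant of the lower
right `1 × 1` block is the entry `a_{55}` itself. -/
def detEven : FreeGL :=
  ∑ σ : Equiv.Perm (Fin 4), (-qpow (-1)) ^ inversions σ •
    (List.ofFn fun i : Fin 4 => fa i.castSucc (σ i).castSucc).prod

/-- The defining relations of the quantum general linear supergroup: the relations of the quantum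
matrix superalgebra, and the invertibility of the quantum determinants of the diagonal blocks. -/
inductive GLRel : FreeGL → FreeGL → Prop
  | odd_sq (i j : Fin 5) (h : parity i j = 1) : GLRel (fa i j * fa i j) 0
  | row (i j l : Fin 5) (h : j < l) :
      GLRel (fa i j * fa i l)
        ((sgn (parity i j * parity i l) * qpow ((-1) ^ (par i + 1))) • (fa i l * fa i j))
  | col (i k j : Fin 5) (h : i < k) :
      GLRel (fa i j * fa k j)
        ((sgn (parity i j * parity k j) * qpow ((-1) ^ (par j + 1))) • (fa k j * fa i j))
  | anti (i j k l : Fin 5) (h : (i < k ∧ l < j) ∨ (k < i ∧ j < l)) :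
      GLRel (fa i j * fa k l) (sgn (parity i j * parity k l) • (fa k l * fa i j))
  | main (i j k l : Fin 5) (hik : i < k) (hjl : j < l) :
      GLRel (fa i j * fa k l - sgn (parity i j * parity k l) • (fa k l * fa i j))
        ((sgn (parity i j * parity k j) * (qpow (-1) - qpow 1)) • (fa k j * fa i l))
  | detEven_inv : GLRel (detEven * FreeAlgebra.ι Cq Gen.invDetEven) 1
  | inv_detEven : GLRel (FreeAlgebra.ι Cq Gen.invDetEven * detEven) 1
  | detOdd_inv : GLRel (fa 4 4 * FreeAlgebra.ι Cq Gen.invDetOdd) 1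
  | inv_detOdd : GLRel (FreeAlgebra.ι Cq Gen.invDetOdd * fa 4 4) 1

/-- The algebra of the quantum general linear supergroup `GL_q(4|1)`. -/
def OGL : Type := RingQuot GLRel

instance : Ring OGL := inferInstanceAs (Ring (RingQuot GLRel))

instance : Algebra Cq OGL := inferInstanceAs (Algebra Cq (RingQuot GLRel))

/-- The quotient map from the free algebra. -/
def toGL : FreeGL →ₐ[Cq] OGL := RingQuot.mkAlgHom Cq GLRel

/-- The matrix entry `g_{ij}` in the algebra of `GL_q(4|1)`. -/
def g (i j : Fin 5) : OGL := toGL (fa i j)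

/-- The relations that cut out the quantum lower parabolic supergroup, the stabilizer of the big
cell: the entries in the rows `1, 2` and the columns `3, 4, 5` vanish. -/
inductive ParRel : OGL → OGL → Prop
  | zero (i j : Fin 5) (hi : i < 2) (hj : 2 ≤ j) : ParRel (g i j) 0

/-- The algebra of the quantum lower parabolic supergroup, the quotient of the algebra of
`GL_q(4|1)` by the two-sided ideal generated by these six entries. -/
def OPar : Type := RingQuot ParRel

instance : Ring OPar := inferInstanceAs (Ring (RingQuot ParRel))

instance : Algebra Cq OPar := inferInstanceAs (Algebra Cq (RingQuot ParRel))

/-- The quotient map from the algebra of `GL_q(4|1)`. -/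
def toPar : OGL →ₐ[Cq] OPar := RingQuot.mkAlgHom Cq ParRel

/-- The matrix entry in row `i` and column `j`, in the algebra of the lower parabolic. -/
def a (i j : Fin 5) : OPar := toPar (g i j)

/-- The quantum minor of the rows `i < j` and the first two columns. -/
def minor (i j : Fin 5) : OPar := a i 0 * a j 1 - qpow (-1) • (a i 1 * a j 0)

/-- The inverse of the quantum minor `D₁₂` of the upper left `2 × 2` block (which is a unit). -/
def invMinor : OPar := Ring.inverse (minor 0 1)

/-- `lower1 r = -q⁻¹ D_{2r} D₁₂⁻¹`: the first column of `t` for the rows `3, 4` and of `τ` for the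
row `5`. -/
def lower1 (r : Fin 5) : OPar := -(qpow (-1) • (minor 1 r * invMinor))

/-- `lower2 r = D_{1r} D₁₂⁻¹`: the second column of `t` for the rows `3, 4` and of `τ` for the
row `5`. -/
def lower2 (r : Fin 5) : OPar := minor 0 r * invMinor

/-- The generators of the algebra of the quantum super Poincaré group, listed in decreasing order:
`τ₅₂ > τ₅₁ > t₃₂ > t₃₁ > t₄₂ > t₄₁ > x₁₁ > x₁₂ > x₂₁ > x₂₂ > y₃₃ > y₃₄ > y₄₃ > y₄₄`. -/
def gen : Fin 14 → OPar :=
  ![lower2 4, lower1 4,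
    lower2 2, lower1 2, lower2 3, lower1 3,
    a 0 0, a 0 1, a 1 0, a 1 1,
    a 2 2, a 2 3, a 3 2, a 3 3]

/-- The algebra `O_q(P)` generated by `x, y, t, τ`. -/
def OqP : Subalgebra Cq OPar := Algebra.adjoin Cq (Set.range gen)

/-- Exponents of ordered monomials: arbitrary for the even generators, and at most `1` for the two
odd generators `τ₅₂` and `τ₅₁`. -/
def Exponent : Type := {e : Fin 14 → ℕ // e 0 ≤ 1 ∧ e 1 ≤ 1}

/-- The ordered monomial with exponents `e`, its factors in decreasing order from left to right. -/
def monomial (e : Exponent) : OPar := (List.ofFn fun i => gen i ^ e.1 i).prod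

end

end QuantumPoincare

/-! The proof has two halves: the ordered monomials span, and they are independent.

Spanning. In the first two columns, entries of different rows satisfy the relations of an ordinary
quantum matrix; the odd row 5 differs only inside the row. Hence the minors `D_{ij}` satisfy
explicit quadratic relations. These pass to `t` and `τ` because `D₁₂`, a unit by the factorization
of the 4 × 4 quantum determinant, commutes with all `D_{1r}` and `D_{2r}` up to the same power of
`q`. Together with the Manin relations for `x` and `y`, they turn every product of two generators in
the wrong order into a combination of products with an earlier first factor
(`gen_mul_gen_mem_earlier`). Such a rewriting terminates (`adjoin_le_span_ordered`), and the squares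
of the two `τ` vanish.

Independence. The parabolic is given by generators and relations, so independence is tested in a
representation. A lower triangular 2 × 2 block of `q`-Weyl operators satisfies the exchange relation
(`exchange_elementary`), and a product of two solutions whose entries commute with each other is
again a solution (`Exchange.mul`). A suitable product of such blocks, of transposed blocks and of a
diagonal matrix acts on a free module `Fock` with basis `ℤ^13 × (ℤ/2)^2`. The exchange relation used
here carries no parity signs: they are absorbed into the coefficient `-q` at the odd index and into
a sign operator multiplying `a₅₅` (`parModel`).

At `q = 1` the even raising operators become multiplications by arbitrary nonzero scalars of a
field, and the odd ones become multiplications by odd variables. The scalars can be solved for so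
that the even generators tend to twelve algebraically independent variables and `τ₅₂`, `τ₅₁` to two
independent combinations of the odd variables (`hasLimit_gen`). The limits of the monomials, applied
to the vacuum, are therefore independent over `ℂ` (`linearIndependent_limit`).

A linear relation over `ℂ[q, q⁻¹]` thus has all its coefficients divisible by `q - 1`. As `Fock` is
torsion-free, the relation can be divided by `q - 1` again and again, and its coefficients vanish
(`linearIndependent_of_specialization`). No localization is needed, so this gives a basis over `ℂ[q,
q⁻¹]` itself. -/

namespace QuantumPoincare

/-! ### Pairs of rows of a quantum matrix with two columns -/

section Rows

variable {k A : Type*} [CommRing k] [Ring A] [Algebra k A]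

/-- The commutation relations between a row `x` of a quantum matrix with two columns and a row `y`
below it. -/
structure RowPair (p q : k) (x y : Fin 2 → A) : Prop where
  col0 : y 0 * x 0 = q • (x 0 * y 0)
  col1 : y 1 * x 1 = q • (x 1 * y 1)
  anti : y 0 * x 1 = x 1 * y 0
  main : y 1 * x 0 = x 0 * y 1 - (p - q) • (x 1 * y 0)

/-- The quantum minor of two rows. -/
def rowMinor (p : k) (x y : Fin 2 → A) : A := x 0 * y 1 - p • (x 1 * y 0)

/-- Lets a commutation rule act in the middle of a right-associated product. -/
theorem left_reassoc {x y e : A} (h : y * x = e) (z : A) : y * (x * z) = e * z := by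
  rw [← mul_assoc, h]

variable {p q : k} {x y z w : Fin 2 → A}

set_option linter.unusedSimpArgs false
set_option linter.unnecessarySeqFocus false

/-- This and the following identities are proved by normal ordering: the relations, used as rewrite
rules, move entries of upper rows to the left, and then the coefficients of the ordered monomials
agree because `p * q = 1`. -/
theorem RowPair.top_mul_minor (hpq : p * q = 1) (hxy : RowPair p q x y)
    (hx : x 1 * x 0 = q • (x 0 * x 1)) (j : Fin 2) :
    x j * rowMinor p x y = rowMinor p x y * x j := by
  obtain ⟨hxy1, hxy2, hxy3, hxy4⟩ := hxy
  fin_cases j <;>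
    simp only [rowMinor, mul_sub, sub_mul, mul_assoc, mul_smul_comm, smul_mul_assoc, smul_sub,
      smul_smul, smul_zero, mul_zero, zero_mul, neg_smul, mul_neg, neg_mul, smul_neg,
      Fin.zero_eta, Fin.mk_one, hxy1, hxy2, hxy3, hxy4, hx, left_reassoc hxy1, left_reassoc
      hxy2, left_reassoc hxy3, left_reassoc hxy4, left_reassoc hx] <;>
    match_scalars <;> grind

theorem RowPair.bot_mul_minor (hpq : p * q = 1) (hxy : RowPair p q x y)
    (hy : y 1 * y 0 = q • (y 0 * y 1)) (j : Fin 2) :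
    y j * rowMinor p x y = rowMinor p x y * y j := by
  obtain ⟨hxy1, hxy2, hxy3, hxy4⟩ := hxy
  fin_cases j <;>
    simp only [rowMinor, mul_sub, sub_mul, mul_assoc, mul_smul_comm, smul_mul_assoc, smul_sub,
      smul_smul, smul_zero, mul_zero, zero_mul, neg_smul, mul_neg, neg_mul, smul_neg,
      Fin.zero_eta, Fin.mk_one, hxy1, hxy2, hxy3, hxy4, hy, left_reassoc hxy1, left_reassoc
      hxy2, left_reassoc hxy3, left_reassoc hxy4, left_reassoc hy] <;>
    match_scalars <;> grind

theorem RowPair.top_mul_lower_minor (hpq : p * q = 1) (hxy : RowPair p q x y)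
    (hxz : RowPair p q x z) (hyz : RowPair p q y z)
    (j : Fin 2) :
    x j * rowMinor p y z = p • (rowMinor p y z * x j) := by
  obtain ⟨hxy1, hxy2, hxy3, hxy4⟩ := hxy
  obtain ⟨hxz1, hxz2, hxz3, hxz4⟩ := hxz
  obtain ⟨hyz1, hyz2, hyz3, hyz4⟩ := hyz
  fin_cases j <;>
    simp only [rowMinor, mul_sub, sub_mul, mul_assoc, mul_smul_comm, smul_mul_assoc, smul_sub,
      smul_smul, smul_zero, mul_zero, zero_mul, neg_smul, mul_neg, neg_mul, smul_neg,
      Fin.zero_eta, Fin.mk_one, hxy1, hxy2, hxy3, hxy4, hxz1, hxz2, hxz3, hxz4, hyz1, hyz2,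
      hyz3, hyz4, left_reassoc hxy1, left_reassoc hxy2, left_reassoc hxy3, left_reassoc hxy4,
      left_reassoc hxz1, left_reassoc hxz2, left_reassoc hxz3, left_reassoc hxz4, left_reassoc
      hyz1, left_reassoc hyz2, left_reassoc hyz3, left_reassoc hyz4] <;>
    match_scalars <;> grind

theorem RowPair.mid_mul_outer_minor (hpq : p * q = 1) (hxy : RowPair p q x y)
    (hxz : RowPair p q x z) (hyz : RowPair p q y z)
    (j : Fin 2) :
    y j * rowMinor p x z =
      p • (rowMinor p x z * y j) + (1 - p * p) • (rowMinor p y z * x j) := by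
  obtain ⟨hxy1, hxy2, hxy3, hxy4⟩ := hxy
  obtain ⟨hxz1, hxz2, hxz3, hxz4⟩ := hxz
  obtain ⟨hyz1, hyz2, hyz3, hyz4⟩ := hyz
  fin_cases j <;>
    simp only [rowMinor, mul_sub, sub_mul, mul_assoc, mul_smul_comm, smul_mul_assoc, smul_sub,
      smul_smul, smul_zero, mul_zero, zero_mul, neg_smul, mul_neg, neg_mul, smul_neg,
      Fin.zero_eta, Fin.mk_one, hxy1, hxy2, hxy3, hxy4, hxz1, hxz2, hxz3, hxz4, hyz1, hyz2,
      hyz3, hyz4, left_reassoc hxy1, left_reassoc hxy2, left_reassoc hxy3, left_reassoc hxy4,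
      left_reassoc hxz1, left_reassoc hxz2, left_reassoc hxz3, left_reassoc hxz4, left_reassoc
      hyz1, left_reassoc hyz2, left_reassoc hyz3, left_reassoc hyz4] <;>
    match_scalars <;> grind

theorem RowPair.minor_mul_minor_same_top (hpq : p * q = 1) (hxy : RowPair p q x y)
    (hxz : RowPair p q x z) (hyz : RowPair p q y z)
    (hx : x 1 * x 0 = q • (x 0 * x 1)) :
    rowMinor p x z * rowMinor p x y = q • (rowMinor p x y * rowMinor p x z) := by
  obtain ⟨hxy1, hxy2, hxy3, hxy4⟩ := hxy
  obtain ⟨hxz1, hxz2, hxz3, hxz4⟩ := hxz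
  obtain ⟨hyz1, hyz2, hyz3, hyz4⟩ := hyz
  simp only [rowMinor, mul_sub, sub_mul, mul_assoc, mul_smul_comm, smul_mul_assoc, smul_sub,
    smul_smul, smul_zero, mul_zero, zero_mul, neg_smul, mul_neg, neg_mul, smul_neg, hxy1,
    hxy2, hxy3, hxy4, hxz1, hxz2, hxz3, hxz4, hyz1, hyz2, hyz3, hyz4, hx, left_reassoc hxy1,
    left_reassoc hxy2, left_reassoc hxy3, left_reassoc hxy4, left_reassoc hxz1, left_reassoc
    hxz2, left_reassoc hxz3, left_reassoc hxz4, left_reassoc hyz1, left_reassoc hyz2,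
    left_reassoc hyz3, left_reassoc hyz4, left_reassoc hx]
  match_scalars <;> grind

theorem RowPair.minor_mul_minor_consecutive (hpq : p * q = 1) (hxy : RowPair p q x y)
    (hxz : RowPair p q x z) (hyz : RowPair p q y z)
    (hy : y 1 * y 0 = q • (y 0 * y 1)) :
    rowMinor p y z * rowMinor p x y = q • (rowMinor p x y * rowMinor p y z) := by
  obtain ⟨hxy1, hxy2, hxy3, hxy4⟩ := hxy
  obtain ⟨hxz1, hxz2, hxz3, hxz4⟩ := hxz
  obtain ⟨hyz1, hyz2, hyz3, hyz4⟩ := hyz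
  simp only [rowMinor, mul_sub, sub_mul, mul_assoc, mul_smul_comm, smul_mul_assoc, smul_sub,
    smul_smul, smul_zero, mul_zero, zero_mul, neg_smul, mul_neg, neg_mul, smul_neg, hxy1,
    hxy2, hxy3, hxy4, hxz1, hxz2, hxz3, hxz4, hyz1, hyz2, hyz3, hyz4, hy, left_reassoc hxy1,
    left_reassoc hxy2, left_reassoc hxy3, left_reassoc hxy4, left_reassoc hxz1, left_reassoc
    hxz2, left_reassoc hxz3, left_reassoc hxz4, left_reassoc hyz1, left_reassoc hyz2,
    left_reassoc hyz3, left_reassoc hyz4, left_reassoc hy]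
  match_scalars <;> grind

theorem RowPair.inner_mul_outer (hpq : p * q = 1) (hxy : RowPair p q x y) (hxz : RowPair p q x z)
    (hxw : RowPair p q x w) (hyz : RowPair p q y z) (hyw : RowPair p q y w) (hzw : RowPair p q z w)
     :
    rowMinor p y z * rowMinor p x w = rowMinor p x w * rowMinor p y z := by
  obtain ⟨hxy1, hxy2, hxy3, hxy4⟩ := hxy
  obtain ⟨hxz1, hxz2, hxz3, hxz4⟩ := hxz
  obtain ⟨hxw1, hxw2, hxw3, hxw4⟩ := hxw
  obtain ⟨hyz1, hyz2, hyz3, hyz4⟩ := hyz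
  obtain ⟨hyw1, hyw2, hyw3, hyw4⟩ := hyw
  obtain ⟨hzw1, hzw2, hzw3, hzw4⟩ := hzw
  simp only [rowMinor, mul_sub, sub_mul, mul_assoc, mul_smul_comm, smul_mul_assoc, smul_sub,
    smul_smul, smul_zero, mul_zero, zero_mul, neg_smul, mul_neg, neg_mul, smul_neg, hxy1,
    hxy2, hxy3, hxy4, hxz1, hxz2, hxz3, hxz4, hxw1, hxw2, hxw3, hxw4, hyz1, hyz2, hyz3, hyz4,
    hyw1, hyw2, hyw3, hyw4, hzw1, hzw2, hzw3, hzw4, left_reassoc hxy1, left_reassoc hxy2,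
    left_reassoc hxy3, left_reassoc hxy4, left_reassoc hxz1, left_reassoc hxz2, left_reassoc
    hxz3, left_reassoc hxz4, left_reassoc hxw1, left_reassoc hxw2, left_reassoc hxw3,
    left_reassoc hxw4, left_reassoc hyz1, left_reassoc hyz2, left_reassoc hyz3, left_reassoc
    hyz4, left_reassoc hyw1, left_reassoc hyw2, left_reassoc hyw3, left_reassoc hyw4,
    left_reassoc hzw1, left_reassoc hzw2, left_reassoc hzw3, left_reassoc hzw4]
  match_scalars <;> grind

theorem RowPair.minor_mul_minor_nested (hpq : p * q = 1) (hxy : RowPair p q x y)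
    (hxz : RowPair p q x z) (hxw : RowPair p q x w) (hyz : RowPair p q y z) (hyw : RowPair p q y w)
    (hzw : RowPair p q z w)
     :
    rowMinor p y w * rowMinor p x z =
      rowMinor p x z * rowMinor p y w + (q - p) • (rowMinor p x w * rowMinor p y z) := by
  obtain ⟨hxy1, hxy2, hxy3, hxy4⟩ := hxy
  obtain ⟨hxz1, hxz2, hxz3, hxz4⟩ := hxz
  obtain ⟨hxw1, hxw2, hxw3, hxw4⟩ := hxw
  obtain ⟨hyz1, hyz2, hyz3, hyz4⟩ := hyz
  obtain ⟨hyw1, hyw2, hyw3, hyw4⟩ := hyw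
  obtain ⟨hzw1, hzw2, hzw3, hzw4⟩ := hzw
  simp only [rowMinor, mul_sub, sub_mul, mul_assoc, mul_smul_comm, smul_mul_assoc, smul_sub,
    smul_smul, smul_zero, mul_zero, zero_mul, neg_smul, mul_neg, neg_mul, smul_neg, hxy1,
    hxy2, hxy3, hxy4, hxz1, hxz2, hxz3, hxz4, hxw1, hxw2, hxw3, hxw4, hyz1, hyz2, hyz3, hyz4,
    hyw1, hyw2, hyw3, hyw4, hzw1, hzw2, hzw3, hzw4, left_reassoc hxy1, left_reassoc hxy2,
    left_reassoc hxy3, left_reassoc hxy4, left_reassoc hxz1, left_reassoc hxz2, left_reassoc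
    hxz3, left_reassoc hxz4, left_reassoc hxw1, left_reassoc hxw2, left_reassoc hxw3,
    left_reassoc hxw4, left_reassoc hyz1, left_reassoc hyz2, left_reassoc hyz3, left_reassoc
    hyz4, left_reassoc hyw1, left_reassoc hyw2, left_reassoc hyw3, left_reassoc hyw4,
    left_reassoc hzw1, left_reassoc hzw2, left_reassoc hzw3, left_reassoc hzw4]
  match_scalars <;> grind

theorem RowPair.minor_mul_minor_same_bot (hpq : p * q = 1) (hxy : RowPair p q x y)
    (hxz : RowPair p q x z) (hyz : RowPair p q y z)
    (hz : z 1 * z 0 = q • (z 0 * z 1)) :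
    rowMinor p y z * rowMinor p x z = q • (rowMinor p x z * rowMinor p y z) := by
  obtain ⟨hxy1, hxy2, hxy3, hxy4⟩ := hxy
  obtain ⟨hxz1, hxz2, hxz3, hxz4⟩ := hxz
  obtain ⟨hyz1, hyz2, hyz3, hyz4⟩ := hyz
  simp only [rowMinor, mul_sub, sub_mul, mul_assoc, mul_smul_comm, smul_mul_assoc, smul_sub,
    smul_smul, smul_zero, mul_zero, zero_mul, neg_smul, mul_neg, neg_mul, smul_neg, hxy1,
    hxy2, hxy3, hxy4, hxz1, hxz2, hxz3, hxz4, hyz1, hyz2, hyz3, hyz4, hz, left_reassoc hxy1,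
    left_reassoc hxy2, left_reassoc hxy3, left_reassoc hxy4, left_reassoc hxz1, left_reassoc
    hxz2, left_reassoc hxz3, left_reassoc hxz4, left_reassoc hyz1, left_reassoc hyz2,
    left_reassoc hyz3, left_reassoc hyz4, left_reassoc hz]
  match_scalars <;> grind

/-- The odd bottom row is the source of the anticommutation of the two `τ`: inside it `-p` takes the
place of `q`, and the terms with a square of one of its entries drop out. -/
theorem RowPair.minor_mul_minor_same_odd_bot (hpq : p * q = 1) (hxy : RowPair p q x y)
    (hxz : RowPair p q x z) (hyz : RowPair p q y z)
    (hz : z 1 * z 0 = -p • (z 0 * z 1)) (hz0 : z 0 * z 0 = 0) (hz1 : z 1 * z 1 = 0) :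
    rowMinor p y z * rowMinor p x z = -p • (rowMinor p x z * rowMinor p y z) := by
  obtain ⟨hxy1, hxy2, hxy3, hxy4⟩ := hxy
  obtain ⟨hxz1, hxz2, hxz3, hxz4⟩ := hxz
  obtain ⟨hyz1, hyz2, hyz3, hyz4⟩ := hyz
  simp only [rowMinor, mul_sub, sub_mul, mul_assoc, mul_smul_comm, smul_mul_assoc, smul_sub,
    smul_smul, smul_zero, mul_zero, zero_mul, neg_smul, mul_neg, neg_mul, smul_neg, hxy1,
    hxy2, hxy3, hxy4, hxz1, hxz2, hxz3, hxz4, hyz1, hyz2, hyz3, hyz4, hz, hz0, hz1,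
    left_reassoc hxy1, left_reassoc hxy2, left_reassoc hxy3, left_reassoc hxy4, left_reassoc
    hxz1, left_reassoc hxz2, left_reassoc hxz3, left_reassoc hxz4, left_reassoc hyz1,
    left_reassoc hyz2, left_reassoc hyz3, left_reassoc hyz4, left_reassoc hz, left_reassoc
    hz0, left_reassoc hz1]
  match_scalars <;> grind

theorem RowPair.odd_minor_sq (hpq : p * q = 1) (hxy : RowPair p q x y)
    (hx : x 1 * x 0 = q • (x 0 * x 1)) (hy : y 1 * y 0 = -p • (y 0 * y 1)) (hy0 : y 0 * y 0 = 0)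
        (hy1 : y 1 * y 1 = 0) :
    rowMinor p x y * rowMinor p x y = 0 := by
  obtain ⟨hxy1, hxy2, hxy3, hxy4⟩ := hxy
  simp only [rowMinor, mul_sub, sub_mul, mul_assoc, mul_smul_comm, smul_mul_assoc, smul_sub,
    smul_smul, smul_zero, mul_zero, zero_mul, neg_smul, mul_neg, neg_mul, smul_neg, hxy1,
    hxy2, hxy3, hxy4, hx, hy, hy0, hy1, left_reassoc hxy1, left_reassoc hxy2, left_reassoc
    hxy3, left_reassoc hxy4, left_reassoc hx, left_reassoc hy, left_reassoc hy0, left_reassoc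
    hy1]
  match_scalars <;> grind

end Rows

end QuantumPoincare

namespace QuantumPoincare

/-! ### Straightening words -/

section Straightening

variable {n : ℕ}

/-- The value of a word in the letters `0, …, n - 1`, read as a number in base `n`. -/
def wordValue : List (Fin n) → ℕ
  | [] => 0
  | a :: l => a * n ^ l.length + wordValue l

theorem wordValue_append_lt (u : List (Fin n)) {v w : List (Fin n)} (hl : v.length = w.length)
    (h : wordValue v < wordValue w) : wordValue (u ++ v) < wordValue (u ++ w) := by
  induction u with
  | nil => exact h
  | cons a u ih => simpa [wordValue, hl] using ih

/-- A smaller leading digit outweighs any change of the next digit. This is why the straightening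
relations have to control only the first factor of each term. -/
theorem wordValue_cons_cons_lt {a b i j : Fin n} (h : a < j) (v : List (Fin n)) :
    wordValue (a :: b :: v) < wordValue (j :: i :: v) := by
  have hb : (b : ℕ) * n ^ v.length < n * n ^ v.length :=
    Nat.mul_lt_mul_of_pos_right b.2 (pow_pos (Nat.zero_lt_of_lt b.2) _)
  have hj : ((a : ℕ) + 1) * (n * n ^ v.length) ≤ j * (n * n ^ v.length) :=
    Nat.mul_le_mul_right _ h
  simp only [wordValue, List.length_cons, pow_succ']
  rw [add_mul, one_mul] at hj
  omega

theorem sorted_or_exists_descent (l : List (Fin n)) :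
    l.Pairwise (· ≤ ·) ∨ ∃ u i j v, i < j ∧ l = u ++ j :: i :: v := by
  rw [← List.isChain_iff_pairwise]
  induction l with
  | nil => exact Or.inl .nil
  | cons a l ih =>
    rcases ih with h | ⟨u, i, j, v, hij, rfl⟩
    · cases l with
      | nil => exact Or.inl (.singleton a)
      | cons b l =>
        rcases le_or_gt a b with hab | hab
        · exact Or.inl (.cons_cons hab h)
        · exact Or.inr ⟨[], b, a, l, hab, rfl⟩
    · exact Or.inr ⟨a :: u, i, j, v, hij, rfl⟩

theorem eq_flatten_replicate_of_sorted {l : List (Fin n)} (h : l.Pairwise (· ≤ ·)) :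
    l = ((List.finRange n).map fun i => List.replicate (l.count i) i).flatten := by
  refine List.Perm.eq_of_pairwise (fun a b _ _ => le_antisymm) h ?_ ?_
  · rw [List.pairwise_flatten]
    refine ⟨?_, ?_⟩
    · intro m hm
      obtain ⟨i, -, rfl⟩ := List.mem_map.1 hm
      exact List.pairwise_replicate.2 (Or.inr le_rfl)
    · rw [List.pairwise_map]
      refine (List.pairwise_lt_finRange n).imp fun {a b} hab x hx y hy => ?_
      rw [List.eq_of_mem_replicate hx, List.eq_of_mem_replicate hy]
      exact hab.le
  · rw [List.perm_iff_count]
    intro a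
    rw [List.count_flatten, List.map_map]
    have : (List.count a ∘ fun i => List.replicate (l.count i) i) =
        fun i => if i = a then l.count a else 0 := by
      funext i
      by_cases hi : i = a
      · subst hi; simp
      · simp [List.count_replicate, hi]
    rw [this, ← List.ofFn_eq_map, List.sum_ofFn]
    simp

variable {k A : Type*} [CommRing k] [Ring A] [Algebra k A]

theorem prod_map_of_sorted (g : Fin n → A) {l : List (Fin n)} (h : l.Pairwise (· ≤ ·)) :
    (l.map g).prod = (List.ofFn fun i => g i ^ l.count i).prod := by
  conv_lhs => rw [eq_flatten_replicate_of_sorted h]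
  rw [List.map_flatten, List.prod_flatten, List.map_map, List.map_map, List.ofFn_eq_map]
  congr 2
  funext i
  simp

/-- If the product of any two generators in the wrong order is a combination of products with a
smaller first factor, then the ordered monomials span. -/
theorem adjoin_le_span_ordered (g : Fin n → A)
    (hg : ∀ i j, i < j → g j * g i ∈ Submodule.span k {z | ∃ a b, a < j ∧ z = g a * g b}) :
    Subalgebra.toSubmodule (Algebra.adjoin k (Set.range g)) ≤
      Submodule.span k (Set.range fun e : Fin n → ℕ => (List.ofFn fun i => g i ^ e i).prod) := by
  -- Induction on the value of the word: replacing a descent `j i` by `a b` with `a < j` keeps the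
  -- length and lowers the value, whatever surrounds it.
  have key : ∀ N : ℕ, ∀ l : List (Fin n), wordValue l = N → (l.map g).prod ∈
      Submodule.span k (Set.range fun e : Fin n → ℕ => (List.ofFn fun i => g i ^ e i).prod) := by
    intro N
    induction N using Nat.strong_induction_on with
    | _ N ih =>
      intro l hl
      rcases sorted_or_exists_descent l with h | ⟨u, i, j, v, hij, rfl⟩
      · exact Submodule.subset_span ⟨fun i => l.count i, (prod_map_of_sorted g h).symm⟩
      -- The product is the image of `g j * g i` under the linear map `z ↦ u z v`, so membership in
      -- the span can be checked on the spanning products `g a * g b`.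
      · have h1 : ((u ++ j :: i :: v).map g).prod =
            (LinearMap.mulLeft k (u.map g).prod ∘ₗ LinearMap.mulRight k (v.map g).prod)
              (g j * g i) := by
          simp [mul_assoc]
        rw [h1]
        refine Submodule.mem_comap.1 ((Submodule.span_le.2 ?_ :
          Submodule.span k {z | ∃ a b, a < j ∧ z = g a * g b} ≤ Submodule.comap _ _) (hg i j hij))
        rintro _ ⟨a, b, haj, rfl⟩
        have h2 : (LinearMap.mulLeft k (u.map g).prod ∘ₗ LinearMap.mulRight k (v.map g).prod)
            (g a * g b) = ((u ++ a :: b :: v).map g).prod := by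
          simp [mul_assoc]
        rw [SetLike.mem_coe, Submodule.mem_comap, h2]
        exact ih _ (hl ▸ wordValue_append_lt u rfl (wordValue_cons_cons_lt haj v)) _ rfl
  rw [Algebra.adjoin_eq_span, Submodule.span_le]
  intro z hz
  obtain ⟨l, hl, rfl⟩ := Submonoid.exists_list_of_mem_closure hz
  have : ∃ m : List (Fin n), l = m.map g := by
    clear hz
    induction l with
    | nil => exact ⟨[], rfl⟩
    | cons a l ih =>
      obtain ⟨m, rfl⟩ := ih fun y hy => hl y (List.mem_cons_of_mem _ hy)
      obtain ⟨i, rfl⟩ := hl a List.mem_cons_self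
      exact ⟨i :: m, rfl⟩
  obtain ⟨m, rfl⟩ := this
  exact key _ m rfl

end Straightening
end QuantumPoincare

namespace QuantumPoincare

noncomputable section

/-! ### Relations in the parabolic -/

theorem qpow_neg_mul_qpow : qpow (-1) * qpow 1 = 1 := by
  rw [qpow, qpow, ← LaurentPolynomial.T_add, neg_add_cancel, LaurentPolynomial.T_zero]

theorem toPar_toGL_rel {u v : FreeGL} (h : GLRel u v) : toPar (toGL u) = toPar (toGL v) :=
  congrArg toPar (RingQuot.mkAlgHom_rel Cq h)

theorem a_eq (i j : Fin 5) : a i j = toPar (toGL (fa i j)) := rfl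

theorem a_zero {i j : Fin 5} (hi : i < 2) (hj : 2 ≤ j) : a i j = 0 :=
  (RingQuot.mkAlgHom_rel Cq (ParRel.zero i j hi hj)).trans (map_zero _)

theorem a_odd_sq {i j : Fin 5} (h : parity i j = 1) : a i j * a i j = 0 := by
  simpa [a_eq] using toPar_toGL_rel (GLRel.odd_sq i j h)

theorem a_row (i j l : Fin 5) (h : j < l) : a i j * a i l =
    (sgn (parity i j * parity i l) * qpow ((-1) ^ (par i + 1))) • (a i l * a i j) := by
  simpa [a_eq] using toPar_toGL_rel (GLRel.row i j l h)

theorem a_col (i k j : Fin 5) (h : i < k) : a i j * a k j =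
    (sgn (parity i j * parity k j) * qpow ((-1) ^ (par j + 1))) • (a k j * a i j) := by
  simpa [a_eq] using toPar_toGL_rel (GLRel.col i k j h)

theorem a_anti (i j k l : Fin 5) (h : (i < k ∧ l < j) ∨ (k < i ∧ j < l)) :
    a i j * a k l = sgn (parity i j * parity k l) • (a k l * a i j) := by
  simpa [a_eq] using toPar_toGL_rel (GLRel.anti i j k l h)

theorem a_main (i j k l : Fin 5) (hik : i < k) (hjl : j < l) :
    a i j * a k l - sgn (parity i j * parity k l) • (a k l * a i j) =
      (sgn (parity i j * parity k j) * (qpow (-1) - qpow 1)) • (a k j * a i l) := by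
  simpa [a_eq] using toPar_toGL_rel (GLRel.main i j k l hik hjl)

theorem parity_even {i j : Fin 5} (hi : i ≠ 4) (hj : j ≠ 4) : parity i j = 0 := by
  simp [parity, par, hi, hj]

theorem qpow_smul_eq {M : Type*} [AddCommGroup M] [Module Cq M] {x y : M}
    (h : x = qpow (-1) • y) : y = qpow 1 • x := by
  rw [h, smul_smul, mul_comm, qpow_neg_mul_qpow, one_smul]

theorem a_row_even {i j l : Fin 5} (hi : i ≠ 4) (hj : j ≠ 4) (h : j < l) :
    a i l * a i j = qpow 1 • (a i j * a i l) := by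
  apply qpow_smul_eq
  simpa [parity_even hi hj, sgn, par, hi] using a_row i j l h

/-- Each sign exponent has the factor `parity i j`, so it is enough that `a i j` is even. The row
`k` may be the odd one, and row 5 is thereby covered here and in the next two lemmas. -/
theorem a_col_even {i k j : Fin 5} (hi : i ≠ 4) (hj : j ≠ 4) (h : i < k) :
    a k j * a i j = qpow 1 • (a i j * a k j) := by
  apply qpow_smul_eq
  simpa [parity_even hi hj, sgn, par, hj] using a_col i k j h

theorem a_anti_even {i j k l : Fin 5} (hi : i ≠ 4) (hj : j ≠ 4)
    (h : (i < k ∧ l < j) ∨ (k < i ∧ j < l)) : a i j * a k l = a k l * a i j := by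
  simpa [parity_even hi hj, sgn] using a_anti i j k l h

theorem a_main_even {i j k l : Fin 5} (hl : l ≠ 4) (hik : i < k) (hjl : j < l) :
    a k l * a i j = a i j * a k l - (qpow (-1) - qpow 1) • (a i l * a k j) := by
  have hi : i ≠ 4 := by omega
  have hj : j ≠ 4 := by omega
  have h := a_main i j k l hik hjl
  rw [← a_anti_even (i := i) (j := l) (k := k) (l := j) hi hl (Or.inl ⟨hik, hjl⟩)] at h
  rw [parity_even hi hj] at h
  simp only [zero_mul, sgn, pow_zero, one_smul, one_mul] at h
  rw [← h]; abel

theorem a_row_odd : a 4 1 * a 4 0 = -qpow (-1) • (a 4 0 * a 4 1) := by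
  have h := a_row 4 0 1 (by decide)
  have h0 : sgn (parity 4 0 * parity 4 1) * qpow ((-1) ^ (par 4 + 1)) = -qpow 1 := by
    have e1 : parity 4 0 * parity 4 1 = 1 := by decide
    have e2 : (-1 : ℤ) ^ (par 4 + 1) = 1 := by decide
    rw [e1, e2, sgn, pow_one, neg_one_mul]
  rw [h0, neg_smul] at h
  rw [h, smul_neg, neg_smul, neg_neg, smul_smul, qpow_neg_mul_qpow, one_smul]

/-- The first two entries of a row. -/
def row (i : Fin 5) : Fin 2 → OPar := ![a i 0, a i 1]

/-- Of two different rows only the lower one can be odd, so no sign appears between them. -/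
theorem rowPair_row {i k : Fin 5} (h : i < k) :
    RowPair (qpow (-1)) (qpow 1) (row i) (row k) where
  col0 := a_col_even (by omega) (by decide) h
  col1 := a_col_even (by omega) (by decide) h
  anti := (a_anti_even (by omega) (by decide) (Or.inl ⟨h, by decide⟩)).symm
  main := a_main_even (by decide) h (by decide)

theorem row_even {i : Fin 5} (hi : i ≠ 4) :
    row i 1 * row i 0 = qpow 1 • (row i 0 * row i 1) :=
  a_row_even hi (by decide) (by decide)

/-- The correction term of the main relation contains `a i l`, an entry of the vanishing upper right
block. -/
theorem commute_upper_lower {i j k l : Fin 5} (hi : i < 2) (hj : j < 2) (hk : 2 ≤ k)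
    (hl : 2 ≤ l) (hl' : l ≠ 4) : Commute (a k l) (a i j) := by
  have h := a_main_even (i := i) (j := j) (k := k) (l := l) hl' (by omega) (by omega)
  rwa [a_zero hi hl, zero_mul, smul_zero, sub_zero] at h

/-! ### The upper left minor is a unit -/

/-- The quantum determinant of a block lower triangular `4 × 4` matrix. -/
theorem qdet_of_blockLower {B : Type*} [Ring B] [Algebra Cq B] (p : Cq) (m : Fin 4 → Fin 4 → B)
    (hm : ∀ i j : Fin 4, i < 2 → 2 ≤ j → m i j = 0) :
    ∑ σ : Equiv.Perm (Fin 4), (-p) ^ inversions σ • (List.ofFn fun i : Fin 4 => m i (σ i)).prod =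
      (m 0 0 * m 1 1 - p • (m 0 1 * m 1 0)) * (m 2 2 * m 3 3 - p • (m 2 3 * m 3 2)) := by
  -- Only four permutations preserve `{0, 1}`; any other one picks an entry of the zero block in row
  -- `0` or row `1`.
  have hσ : ∀ σ : Equiv.Perm (Fin 4),
      σ ∉ ({1, Equiv.swap 0 1, Equiv.swap 2 3, Equiv.swap 0 1 * Equiv.swap 2 3} :
        Finset (Equiv.Perm (Fin 4))) → 2 ≤ σ 0 ∨ 2 ≤ σ 1 := by decide
  rw [← Finset.sum_subset (Finset.subset_univ
    ({1, Equiv.swap 0 1, Equiv.swap 2 3, Equiv.swap 0 1 * Equiv.swap 2 3} :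
        Finset (Equiv.Perm (Fin 4))))]
  · have h0 : inversions 1 = 0 := by decide
    have h1 : inversions (Equiv.swap 0 1) = 1 := by decide
    have h2 : inversions (Equiv.swap 2 3) = 1 := by decide
    have h3 : inversions (Equiv.swap 0 1 * Equiv.swap 2 3) = 2 := by decide
    rw [Finset.sum_insert (by decide), Finset.sum_insert (by decide),
      Finset.sum_insert (by decide), Finset.sum_singleton, h0, h1, h2, h3]
    have e1 : (Equiv.swap (0 : Fin 4) 1) 2 = 2 := by decide
    have e2 : (Equiv.swap (0 : Fin 4) 1) 3 = 3 := by decide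
    have e3 : (Equiv.swap (2 : Fin 4) 3) 0 = 0 := by decide
    have e4 : (Equiv.swap (2 : Fin 4) 3) 1 = 1 := by decide
    simp only [List.ofFn_succ, List.ofFn_zero, List.prod_cons, List.prod_nil, mul_one,
      Fin.succ_zero_eq_one, Fin.succ_one_eq_two, Equiv.Perm.coe_one, id, Equiv.Perm.coe_mul,
      Function.comp_apply, Fin.reduceSucc, Equiv.swap_apply_left, Equiv.swap_apply_right,
      e1, e2, e3, e4, mul_sub, sub_mul, mul_smul_comm, smul_mul_assoc, mul_assoc]
    match_scalars <;> ring
  · intro σ _ h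
    rcases hσ σ h with h | h
    · simp [List.ofFn_succ, hm 0 (σ 0) (by decide) h]
    · simp [List.ofFn_succ, hm 1 (σ 1) (by decide) h]

/-- The target is arbitrary because the factorization is needed both in the parabolic and in the
operator model. -/
theorem map_detEven {B : Type*} [Ring B] [Algebra Cq B] (f : FreeGL →ₐ[Cq] B)
    (hf : ∀ i j : Fin 5, i < 2 → 2 ≤ j → f (fa i j) = 0) :
    f detEven = (f (fa 0 0) * f (fa 1 1) - qpow (-1) • (f (fa 0 1) * f (fa 1 0))) *
      (f (fa 2 2) * f (fa 3 3) - qpow (-1) • (f (fa 2 3) * f (fa 3 2))) := by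
  have := qdet_of_blockLower (qpow (-1)) (fun i j => f (fa i.castSucc j.castSucc))
    (fun i j hi hj => hf _ _ hi hj)
  simp only [detEven, map_sum, map_smul, map_list_prod, List.map_ofFn]
  exact this

/-- The invertible determinant equals `D₁₂ E`, where `E` is the minor of the block `y`. The entries
of `x` commute with those of `y`, so the two factors commute, and commuting factors of a unit are
units. -/
theorem isUnit_minor : IsUnit (minor 0 1) := by
  set E : OPar := a 2 2 * a 3 3 - qpow (-1) • (a 2 3 * a 3 2) with hE
  have hdet : toPar (toGL detEven) = minor 0 1 * E :=
    map_detEven (toPar.comp toGL) fun i j hi hj => a_zero hi hj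
  have hcomm : Commute (minor 0 1) E := by
    have key : ∀ k l : Fin 5, 2 ≤ k → 2 ≤ l → l ≠ 4 → Commute (minor 0 1) (a k l) := by
      intro k l hk hl hl'
      refine Commute.symm (Commute.sub_right ?_ (Commute.smul_right ?_ _)) <;>
      exact Commute.mul_right (commute_upper_lower (by decide) (by decide) hk hl hl')
        (commute_upper_lower (by decide) (by decide) hk hl hl')
    refine Commute.sub_right ?_ (Commute.smul_right ?_ _) <;>
    exact Commute.mul_right (key _ _ (by decide) (by decide) (by decide))
        (key _ _ (by decide) (by decide) (by decide))
  have hu : IsUnit (minor 0 1 * E) := by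
    rw [← hdet]
    refine ⟨⟨_, toPar (toGL (FreeAlgebra.ι Cq Gen.invDetEven)), ?_, ?_⟩, rfl⟩
    · rw [← map_mul, ← map_mul, toPar_toGL_rel GLRel.detEven_inv, map_one, map_one]
    · rw [← map_mul, ← map_mul, toPar_toGL_rel GLRel.inv_detEven, map_one, map_one]
  exact (hcomm.isUnit_mul_iff.1 hu).1

end
end QuantumPoincare

namespace QuantumPoincare

noncomputable section

/-! ### Straightening relations for the generators of the quantum Poincaré group -/

theorem minor_mul_invMinor : minor 0 1 * invMinor = 1 := Ring.mul_inverse_cancel _ isUnit_minor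

theorem invMinor_mul_minor : invMinor * minor 0 1 = 1 := Ring.inverse_mul_cancel _ isUnit_minor

theorem commute_invMinor_of_commute {z : OPar} (h : Commute z (minor 0 1)) :
    Commute z invMinor := by
  obtain ⟨u, hu⟩ := isUnit_minor
  rw [invMinor, ← hu, Ring.inverse_unit]
  rw [← hu] at h
  exact h.units_inv_right

theorem commute_upper_invMinor {i : Fin 5} (hi : i < 2) (j : Fin 2) :
    Commute (row i j) invMinor := by
  apply commute_invMinor_of_commute
  have h : i = 0 ∨ i = 1 := by omega
  rcases h with rfl | rfl
  · exact (rowPair_row (by decide)).top_mul_minor qpow_neg_mul_qpow (row_even (by decide)) j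
  · exact (rowPair_row (by decide)).bot_mul_minor qpow_neg_mul_qpow (row_even (by decide)) j

theorem commute_lower_invMinor {k l : Fin 5} (hk : 2 ≤ k) (hl : 2 ≤ l) (hl' : l ≠ 4) :
    Commute (a k l) invMinor := by
  apply commute_invMinor_of_commute
  refine Commute.sub_right ?_ (Commute.smul_right ?_ _) <;>
  exact Commute.mul_right (commute_upper_lower (by decide) (by decide) hk hl hl')
    (commute_upper_lower (by decide) (by decide) hk hl hl')

theorem row_mul_minor_self {i j : Fin 5} (h : i < j) (l : Fin 2) :
    row i l * minor i j = minor i j * row i l :=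
  (rowPair_row h).top_mul_minor qpow_neg_mul_qpow (row_even (by omega)) l

theorem row_one_mul_minor_zero {r : Fin 5} (hr : 2 ≤ r) (l : Fin 2) :
    row 1 l * minor 0 r = qpow (-1) • (minor 0 r * row 1 l) +
      (1 - qpow (-1) * qpow (-1)) • (minor 1 r * row 0 l) :=
  (rowPair_row (by decide)).mid_mul_outer_minor qpow_neg_mul_qpow
    (rowPair_row (by omega)) (rowPair_row (by omega)) l

theorem row_zero_mul_minor_one {r : Fin 5} (hr : 2 ≤ r) (l : Fin 2) :
    row 0 l * minor 1 r = qpow (-1) • (minor 1 r * row 0 l) :=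
  (rowPair_row (by decide)).top_mul_lower_minor qpow_neg_mul_qpow
    (rowPair_row (by omega)) (rowPair_row (by omega)) l

/-- The minors `D_{1r}` and `D_{2r}` commute with `D_{12}` up to a power of `q`. -/
theorem minor_mul_minor_zero_one {i r : Fin 5} (hi : i < 2) (hr : 2 ≤ r) :
    minor i r * minor 0 1 = qpow 1 • (minor 0 1 * minor i r) := by
  have h : i = 0 ∨ i = 1 := by omega
  rcases h with rfl | rfl
  · exact (rowPair_row (by decide)).minor_mul_minor_same_top qpow_neg_mul_qpow
      (rowPair_row (by omega)) (rowPair_row (by omega)) (row_even (by decide))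
  · exact (rowPair_row (by decide)).minor_mul_minor_consecutive qpow_neg_mul_qpow
      (rowPair_row (by omega)) (rowPair_row (by omega)) (row_even (by decide))

theorem invMinor_mul_minor_lower {i r : Fin 5} (hi : i < 2) (hr : 2 ≤ r) :
    invMinor * minor i r = qpow 1 • (minor i r * invMinor) := by
  calc invMinor * minor i r = invMinor * (minor i r * minor 0 1) * invMinor := by
        rw [mul_assoc, mul_assoc, minor_mul_invMinor, mul_one]
    _ = qpow 1 • (minor i r * invMinor) := by
        rw [minor_mul_minor_zero_one hi hr, mul_smul_comm, ← mul_assoc, invMinor_mul_minor,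
          one_mul, smul_mul_assoc]

/-- Collecting the inverse minors on the right costs the same factor `q` in every product, so the
quadratic relations between minors carry over to `t` and `τ`. -/
theorem minor_mul_invMinor_mul {i j r s : Fin 5} (hj : j < 2) (hs : 2 ≤ s) :
    minor i r * invMinor * (minor j s * invMinor) =
      qpow 1 • (minor i r * minor j s * (invMinor * invMinor)) := by
  rw [mul_assoc, ← mul_assoc invMinor, invMinor_mul_minor_lower hj hs, smul_mul_assoc,
    mul_smul_comm, mul_assoc, mul_assoc]

theorem qpow_mul_qpow_neg : qpow 1 * qpow (-1) = 1 := by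
  rw [mul_comm, qpow_neg_mul_qpow]

theorem row_zero_mul_lower1 {r : Fin 5} (hr : 2 ≤ r) (l : Fin 2) :
    row 0 l * lower1 r = qpow (-1) • (lower1 r * row 0 l) := by
  rw [lower1, mul_neg, mul_smul_comm, ← mul_assoc, row_zero_mul_minor_one hr, neg_mul,
    smul_mul_assoc, smul_mul_assoc, mul_assoc, mul_assoc,
    (commute_upper_invMinor (by decide) l).eq, smul_neg]

theorem row_zero_mul_lower2 {r : Fin 5} (hr : 2 ≤ r) (l : Fin 2) :
    row 0 l * lower2 r = (1 : Cq) • (lower2 r * row 0 l) := by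
  rw [lower2, ← mul_assoc, row_mul_minor_self (by omega), mul_assoc, mul_assoc,
    (commute_upper_invMinor (by decide) l).eq, one_smul]

theorem row_one_mul_lower1 {r : Fin 5} (hr : 2 ≤ r) (l : Fin 2) :
    row 1 l * lower1 r = (1 : Cq) • (lower1 r * row 1 l) := by
  rw [lower1, mul_neg, mul_smul_comm, ← mul_assoc, row_mul_minor_self (by omega), neg_mul,
    smul_mul_assoc, mul_assoc, mul_assoc, (commute_upper_invMinor (by decide) l).eq, one_smul]

theorem row_one_mul_lower2 {r : Fin 5} (hr : 2 ≤ r) (l : Fin 2) :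
    row 1 l * lower2 r = qpow (-1) • (lower2 r * row 1 l) +
      (qpow (-1) - qpow 1) • (lower1 r * row 0 l) := by
  rw [lower2, lower1, ← mul_assoc, row_one_mul_minor_zero hr, add_mul, smul_mul_assoc,
    smul_mul_assoc, mul_assoc, mul_assoc, (commute_upper_invMinor (by decide) l).eq,
    (commute_upper_invMinor (by decide) l).eq, neg_mul, smul_mul_assoc, mul_assoc, mul_assoc]
  match_scalars
  · ring
  · linear_combination -qpow_neg_mul_qpow

theorem lower_entry_mul_minor {i k l r : Fin 5} (hi : i < 2) (hk : 2 ≤ k) (hl : 2 ≤ l)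
    (hl' : l ≠ 4) (hkr : k < r) : a k l * minor i r = minor i r * a k l := by
  have h : ∀ j : Fin 5, j < 2 → a k l * a r j = a r j * a k l := fun j hj =>
    a_anti_even (by omega) hl' (Or.inl ⟨hkr, by omega⟩)
  have h' : ∀ j : Fin 5, j < 2 → a k l * a i j = a i j * a k l := fun j hj =>
    commute_upper_lower hi hj hk hl hl'
  simp only [minor, mul_sub, sub_mul, mul_assoc, mul_smul_comm, smul_mul_assoc,
    h 0 (by decide), h 1 (by decide), left_reassoc (h' 0 (by decide)),
    left_reassoc (h' 1 (by decide))]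

theorem lower_entry_mul_minor_same {i k l : Fin 5} (hi : i < 2) (hk : 2 ≤ k) (hk' : k ≠ 4)
    (hl : 2 ≤ l) (hl' : l ≠ 4) : a k l * minor i k = qpow 1 • (minor i k * a k l) := by
  have h : ∀ j : Fin 5, j < 2 → a k l * a k j = qpow 1 • (a k j * a k l) := fun j hj =>
    a_row_even hk' (by omega) (by omega)
  have h' : ∀ j : Fin 5, j < 2 → a k l * a i j = a i j * a k l := fun j hj =>
    commute_upper_lower hi hj hk hl hl'
  simp only [minor, mul_sub, sub_mul, mul_assoc, mul_smul_comm, smul_mul_assoc,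
    h 0 (by decide), h 1 (by decide), left_reassoc (h' 0 (by decide)),
    left_reassoc (h' 1 (by decide)), smul_sub, smul_comm (qpow 1)]

/-- The correction terms of the main relation exchange the rows `r` and `k` between the minor and
the entry; they assemble into a single minor. -/
theorem lower_entry_mul_minor_above {i k l r : Fin 5} (hi : i < 2) (hr : 2 ≤ r) (hrk : r < k)
    (hl : 2 ≤ l) (hl' : l ≠ 4) :
    a k l * minor i r = minor i r * a k l - (qpow (-1) - qpow 1) • (minor i k * a r l) := by
  have h : ∀ j : Fin 5, j < 2 →
      a k l * a r j = a r j * a k l - (qpow (-1) - qpow 1) • (a k j * a r l) := fun j hj => by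
    rw [a_main_even hl' hrk (by omega),
      a_anti_even (by omega) hl' (Or.inl ⟨hrk, by omega⟩)]
  have h' : ∀ j : Fin 5, j < 2 → a k l * a i j = a i j * a k l := fun j hj =>
    commute_upper_lower hi hj (by omega) hl hl'
  simp only [minor, mul_sub, sub_mul, mul_assoc, mul_smul_comm, smul_mul_assoc,
    h 0 (by decide), h 1 (by decide), left_reassoc (h' 0 (by decide)),
    left_reassoc (h' 1 (by decide))]
  module

theorem lower_entry_mul_lower1 {k l r : Fin 5} (hk : 2 ≤ k) (hl : 2 ≤ l) (hl' : l ≠ 4)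
    (hkr : k < r) : a k l * lower1 r = (1 : Cq) • (lower1 r * a k l) := by
  rw [lower1, mul_neg, mul_smul_comm, ← mul_assoc,
    lower_entry_mul_minor (by decide) hk hl hl' hkr, mul_assoc,
    (commute_lower_invMinor hk hl hl').eq, neg_mul, smul_mul_assoc, mul_assoc, one_smul]

theorem lower_entry_mul_lower2 {k l r : Fin 5} (hk : 2 ≤ k) (hl : 2 ≤ l) (hl' : l ≠ 4)
    (hkr : k < r) : a k l * lower2 r = (1 : Cq) • (lower2 r * a k l) := by
  rw [lower2, ← mul_assoc, lower_entry_mul_minor (by decide) hk hl hl' hkr, mul_assoc,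
    (commute_lower_invMinor hk hl hl').eq, mul_assoc, one_smul]

theorem lower_entry_mul_lower1_same {k l : Fin 5} (hk : 2 ≤ k) (hk' : k ≠ 4) (hl : 2 ≤ l)
    (hl' : l ≠ 4) : a k l * lower1 k = qpow 1 • (lower1 k * a k l) := by
  rw [lower1, mul_neg, mul_smul_comm, ← mul_assoc,
    lower_entry_mul_minor_same (by decide) hk hk' hl hl', smul_mul_assoc, mul_assoc,
    (commute_lower_invMinor hk hl hl').eq, neg_mul, smul_mul_assoc, mul_assoc, smul_neg,
    smul_comm]

theorem lower_entry_mul_lower2_same {k l : Fin 5} (hk : 2 ≤ k) (hk' : k ≠ 4) (hl : 2 ≤ l)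
    (hl' : l ≠ 4) : a k l * lower2 k = qpow 1 • (lower2 k * a k l) := by
  rw [lower2, ← mul_assoc, lower_entry_mul_minor_same (by decide) hk hk' hl hl',
    smul_mul_assoc, mul_assoc, (commute_lower_invMinor hk hl hl').eq, mul_assoc]

theorem lower_entry_mul_lower1_above {k l r : Fin 5} (hr : 2 ≤ r) (hrk : r < k) (hl : 2 ≤ l)
    (hl' : l ≠ 4) : a k l * lower1 r = (1 : Cq) • (lower1 r * a k l) +
      (qpow 1 - qpow (-1)) • (lower1 k * a r l) := by
  rw [lower1, lower1, mul_neg, mul_smul_comm, ← mul_assoc,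
    lower_entry_mul_minor_above (by decide) hr hrk hl hl', sub_mul, smul_mul_assoc, mul_assoc,
    mul_assoc, (commute_lower_invMinor (by omega) hl hl').eq,
    (commute_lower_invMinor hr hl hl').eq, neg_mul, neg_mul, smul_mul_assoc, smul_mul_assoc,
    mul_assoc, mul_assoc]
  module

theorem lower_entry_mul_lower2_above {k l r : Fin 5} (hr : 2 ≤ r) (hrk : r < k) (hl : 2 ≤ l)
    (hl' : l ≠ 4) : a k l * lower2 r = (1 : Cq) • (lower2 r * a k l) +
      (qpow 1 - qpow (-1)) • (lower2 k * a r l) := by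
  rw [lower2, lower2, ← mul_assoc, lower_entry_mul_minor_above (by decide) hr hrk hl hl',
    sub_mul, smul_mul_assoc, mul_assoc, mul_assoc,
    (commute_lower_invMinor (by omega) hl hl').eq, (commute_lower_invMinor hr hl hl').eq,
    mul_assoc, mul_assoc]
  module

theorem lower2_mul_lower2 {r s : Fin 5} (hr : 2 ≤ r) (h : r < s) :
    lower2 s * lower2 r = qpow 1 • (lower2 r * lower2 s) := by
  have key : minor 0 s * minor 0 r = qpow 1 • (minor 0 r * minor 0 s) :=
    (rowPair_row (by omega)).minor_mul_minor_same_top qpow_neg_mul_qpow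
      (rowPair_row (by omega)) (rowPair_row h) (row_even (by decide))
  simp only [lower2, minor_mul_invMinor_mul (i := 0) (j := 0) (by decide) hr,
    minor_mul_invMinor_mul (i := 0) (j := 0) (by decide) (hr.trans h.le), key, smul_mul_assoc]

theorem lower1_mul_lower1 {r s : Fin 5} (hr : 2 ≤ r) (h : r < s) :
    lower1 s * lower1 r = qpow 1 • (lower1 r * lower1 s) := by
  have key : minor 1 s * minor 1 r = qpow 1 • (minor 1 r * minor 1 s) :=
    (rowPair_row (by omega)).minor_mul_minor_same_top qpow_neg_mul_qpow
      (rowPair_row (by omega)) (rowPair_row h) (row_even (by decide))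
  simp only [lower1, neg_mul_neg, smul_mul_assoc, mul_smul_comm,
    minor_mul_invMinor_mul (i := 1) (j := 1) (by decide) hr,
    minor_mul_invMinor_mul (i := 1) (j := 1) (by decide) (hr.trans h.le), key]
  module

theorem lower2_mul_lower1 {r s : Fin 5} (hr : 2 ≤ r) (h : r < s) :
    lower2 s * lower1 r = (1 : Cq) • (lower1 r * lower2 s) := by
  have key : minor 1 r * minor 0 s = minor 0 s * minor 1 r :=
    (rowPair_row (by decide)).inner_mul_outer qpow_neg_mul_qpow
      (rowPair_row (by omega)) (rowPair_row (by omega)) (rowPair_row (by omega))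
      (rowPair_row (by omega)) (rowPair_row h)
  simp only [lower1, lower2, neg_mul, mul_neg, smul_mul_assoc, mul_smul_comm,
    minor_mul_invMinor_mul (i := 0) (j := 1) (by decide) hr,
    minor_mul_invMinor_mul (i := 1) (j := 0) (by decide) (hr.trans h.le), key, one_smul]

theorem lower1_mul_lower2 {r s : Fin 5} (hr : 2 ≤ r) (h : r < s) :
    lower1 s * lower2 r = (1 : Cq) • (lower2 r * lower1 s) +
      (qpow 1 - qpow (-1)) • (lower1 r * lower2 s) := by
  have key : minor 1 s * minor 0 r = minor 0 r * minor 1 s +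
      (qpow 1 - qpow (-1)) • (minor 0 s * minor 1 r) :=
    (rowPair_row (by decide)).minor_mul_minor_nested qpow_neg_mul_qpow
      (rowPair_row (by omega)) (rowPair_row (by omega)) (rowPair_row (by omega))
      (rowPair_row (by omega)) (rowPair_row h)
  have key' : minor 1 r * minor 0 s = minor 0 s * minor 1 r :=
    (rowPair_row (by decide)).inner_mul_outer qpow_neg_mul_qpow
      (rowPair_row (by omega)) (rowPair_row (by omega)) (rowPair_row (by omega))
      (rowPair_row (by omega)) (rowPair_row h)
  simp only [lower1, lower2, neg_mul, mul_neg, smul_mul_assoc, mul_smul_comm,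
    minor_mul_invMinor_mul (i := 1) (j := 0) (by decide) hr,
    minor_mul_invMinor_mul (i := 0) (j := 1) (by decide) (hr.trans h.le),
    minor_mul_invMinor_mul (i := 1) (j := 0) (by decide) (hr.trans h.le), key, key', add_mul]
  module

theorem lower1_mul_lower2_same {r : Fin 5} (hr : 2 ≤ r) (hr' : r ≠ 4) :
    lower1 r * lower2 r = qpow 1 • (lower2 r * lower1 r) := by
  have key : minor 1 r * minor 0 r = qpow 1 • (minor 0 r * minor 1 r) :=
    (rowPair_row (by decide)).minor_mul_minor_same_bot qpow_neg_mul_qpow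
      (rowPair_row (by omega)) (rowPair_row (by omega)) (row_even hr')
  simp only [lower1, lower2, neg_mul, mul_neg, smul_mul_assoc, mul_smul_comm,
    minor_mul_invMinor_mul (i := 1) (j := 0) (by decide) hr,
    minor_mul_invMinor_mul (i := 0) (j := 1) (by decide) hr, key]
  module

theorem row_four_sq (j : Fin 2) : row 4 j * row 4 j = 0 := by
  fin_cases j
  · exact a_odd_sq (i := 4) (j := 0) (by decide)
  · exact a_odd_sq (i := 4) (j := 1) (by decide)

theorem lower1_mul_lower2_odd :
    lower1 4 * lower2 4 = -qpow (-1) • (lower2 4 * lower1 4) := by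
  have key : minor 1 4 * minor 0 4 = -qpow (-1) • (minor 0 4 * minor 1 4) :=
    (rowPair_row (by decide)).minor_mul_minor_same_odd_bot qpow_neg_mul_qpow
      (rowPair_row (by decide)) (rowPair_row (by decide)) a_row_odd (row_four_sq 0) (row_four_sq 1)
  simp only [lower1, lower2, neg_mul, mul_neg, smul_mul_assoc, mul_smul_comm,
    minor_mul_invMinor_mul (i := 1) (j := 0) (r := 4) (s := 4) (by decide) (by decide),
    minor_mul_invMinor_mul (i := 0) (j := 1) (r := 4) (s := 4) (by decide) (by decide), key]
  module

theorem minor_odd_sq {i : Fin 5} (hi : i < 2) : minor i 4 * minor i 4 = 0 :=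
  (rowPair_row (by omega)).odd_minor_sq qpow_neg_mul_qpow (row_even (by omega)) a_row_odd
    (row_four_sq 0) (row_four_sq 1)

theorem lower1_odd_sq : lower1 4 * lower1 4 = 0 := by
  rw [lower1, neg_mul_neg, smul_mul_smul_comm, minor_mul_invMinor_mul (by decide) (by decide),
    minor_odd_sq (by decide), zero_mul, smul_zero, smul_zero]

theorem lower2_odd_sq : lower2 4 * lower2 4 = 0 := by
  rw [lower2, minor_mul_invMinor_mul (by decide) (by decide), minor_odd_sq (by decide), zero_mul,
    smul_zero]

end
end QuantumPoincare

/-! ### Spanning by ordered monomials -/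

namespace QuantumPoincare

noncomputable section

/-- The order puts `τ` in front although row 5 lies below the rows of `t`; the relations with row 5
are therefore solved here for the opposite product. -/
theorem lower2_mul_lower2_odd {r : Fin 5} (hr : 2 ≤ r) (h : r < 4) :
    lower2 r * lower2 4 = qpow (-1) • (lower2 4 * lower2 r) := by
  rw [lower2_mul_lower2 hr h, smul_smul, qpow_neg_mul_qpow, one_smul]

theorem lower1_mul_lower1_odd {r : Fin 5} (hr : 2 ≤ r) (h : r < 4) :
    lower1 r * lower1 4 = qpow (-1) • (lower1 4 * lower1 r) := by
  rw [lower1_mul_lower1 hr h, smul_smul, qpow_neg_mul_qpow, one_smul]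

theorem lower1_mul_lower2_odd_row {r : Fin 5} (hr : 2 ≤ r) (h : r < 4) :
    lower1 r * lower2 4 = (1 : Cq) • (lower2 4 * lower1 r) := by
  rw [lower2_mul_lower1 hr h, smul_smul, one_mul, one_smul]

theorem lower2_mul_lower1_odd_row {r : Fin 5} (hr : 2 ≤ r) (h : r < 4) :
    lower2 r * lower1 4 = (1 : Cq) • (lower1 4 * lower2 r) +
      (qpow (-1) - qpow 1) • (lower2 4 * lower1 r) := by
  rw [lower1_mul_lower2 hr h, lower2_mul_lower1 hr h]
  module

theorem upper_main {i j k l : Fin 5} (hl : l ≠ 4) (hik : i < k) (hjl : j < l) :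
    a k l * a i j = (1 : Cq) • (a i j * a k l) +
      (qpow 1 - qpow (-1)) • (a i l * a k j) := by
  rw [a_main_even hl hik hjl]
  module

/-- The space spanned by the products of two generators with first factor before the `j`th. -/
def earlier (j : Fin 14) : Submodule Cq OPar :=
  Submodule.span Cq {z | ∃ k l, k < j ∧ z = gen k * gen l}

theorem mem_one {j : Fin 14} (k l : Fin 14) (h : k < j) {c : Cq} {z : OPar}
    (hz : z = c • (gen k * gen l)) : z ∈ earlier j :=
  hz ▸ Submodule.smul_mem _ _ (Submodule.subset_span ⟨k, l, h, rfl⟩)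

theorem mem_two {j : Fin 14} (k l k' l' : Fin 14) (h : k < j) (h' : k' < j) {c c' : Cq} {z : OPar}
    (hz : z = c • (gen k * gen l) + c' • (gen k' * gen l')) : z ∈ earlier j :=
  hz ▸ add_mem (mem_one k l h rfl) (mem_one k' l' h' rfl)

theorem one_smul_eq {x y : OPar} (h : x = y) : x = (1 : Cq) • y := by
  rw [h, one_smul]

/-- Each pair has a relation with one or two terms on the right; the numerals name the generators in
these terms. -/
theorem gen_mul_gen_mem_earlier (i j : Fin 14) (h : i < j) : gen j * gen i ∈ earlier j := by
  fin_cases j <;> fin_cases i <;> try exact absurd h (by decide)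
  · exact mem_one 0 1 (by decide) lower1_mul_lower2_odd
  · exact mem_one 0 2 (by decide) (lower2_mul_lower2_odd (by decide) (by decide))
  · exact mem_two 1 2 0 3 (by decide) (by decide) (lower2_mul_lower1_odd_row (by decide)
      (by decide))
  · exact mem_one 0 3 (by decide) (lower1_mul_lower2_odd_row (by decide) (by decide))
  · exact mem_one 1 3 (by decide) (lower1_mul_lower1_odd (by decide) (by decide))
  · exact mem_one 2 3 (by decide) (lower1_mul_lower2_same (by decide) (by decide))
  · exact mem_one 0 4 (by decide) (lower2_mul_lower2_odd (by decide) (by decide))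
  · exact mem_two 1 4 0 5 (by decide) (by decide) (lower2_mul_lower1_odd_row (by decide)
      (by decide))
  · exact mem_one 2 4 (by decide) (lower2_mul_lower2 (by decide) (by decide))
  · exact mem_one 3 4 (by decide) (lower2_mul_lower1 (by decide) (by decide))
  · exact mem_one 0 5 (by decide) (lower1_mul_lower2_odd_row (by decide) (by decide))
  · exact mem_one 1 5 (by decide) (lower1_mul_lower1_odd (by decide) (by decide))
  · exact mem_two 2 5 3 4 (by decide) (by decide) (lower1_mul_lower2 (by decide) (by decide))
  · exact mem_one 3 5 (by decide) (lower1_mul_lower1 (by decide) (by decide))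
  · exact mem_one 4 5 (by decide) (lower1_mul_lower2_same (by decide) (by decide))
  · exact mem_one 0 6 (by decide) (row_zero_mul_lower2 (by decide) 0)
  · exact mem_one 1 6 (by decide) (row_zero_mul_lower1 (by decide) 0)
  · exact mem_one 2 6 (by decide) (row_zero_mul_lower2 (by decide) 0)
  · exact mem_one 3 6 (by decide) (row_zero_mul_lower1 (by decide) 0)
  · exact mem_one 4 6 (by decide) (row_zero_mul_lower2 (by decide) 0)
  · exact mem_one 5 6 (by decide) (row_zero_mul_lower1 (by decide) 0)
  · exact mem_one 0 7 (by decide) (row_zero_mul_lower2 (by decide) 1)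
  · exact mem_one 1 7 (by decide) (row_zero_mul_lower1 (by decide) 1)
  · exact mem_one 2 7 (by decide) (row_zero_mul_lower2 (by decide) 1)
  · exact mem_one 3 7 (by decide) (row_zero_mul_lower1 (by decide) 1)
  · exact mem_one 4 7 (by decide) (row_zero_mul_lower2 (by decide) 1)
  · exact mem_one 5 7 (by decide) (row_zero_mul_lower1 (by decide) 1)
  · exact mem_one 6 7 (by decide) (a_row_even (by decide) (by decide) (by decide))
  · exact mem_two 0 8 1 6 (by decide) (by decide) (row_one_mul_lower2 (by decide) 0)
  · exact mem_one 1 8 (by decide) (row_one_mul_lower1 (by decide) 0)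
  · exact mem_two 2 8 3 6 (by decide) (by decide) (row_one_mul_lower2 (by decide) 0)
  · exact mem_one 3 8 (by decide) (row_one_mul_lower1 (by decide) 0)
  · exact mem_two 4 8 5 6 (by decide) (by decide) (row_one_mul_lower2 (by decide) 0)
  · exact mem_one 5 8 (by decide) (row_one_mul_lower1 (by decide) 0)
  · exact mem_one 6 8 (by decide) (a_col_even (by decide) (by decide) (by decide))
  · exact mem_one 7 8 (by decide) (one_smul_eq (a_anti_even (by decide) (by decide) (Or.inr
      (by decide))))
  · exact mem_two 0 9 1 7 (by decide) (by decide) (row_one_mul_lower2 (by decide) 1)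
  · exact mem_one 1 9 (by decide) (row_one_mul_lower1 (by decide) 1)
  · exact mem_two 2 9 3 7 (by decide) (by decide) (row_one_mul_lower2 (by decide) 1)
  · exact mem_one 3 9 (by decide) (row_one_mul_lower1 (by decide) 1)
  · exact mem_two 4 9 5 7 (by decide) (by decide) (row_one_mul_lower2 (by decide) 1)
  · exact mem_one 5 9 (by decide) (row_one_mul_lower1 (by decide) 1)
  · exact mem_two 6 9 7 8 (by decide) (by decide) (upper_main (by decide) (by decide) (by decide))
  · exact mem_one 7 9 (by decide) (a_col_even (by decide) (by decide) (by decide))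
  · exact mem_one 8 9 (by decide) (a_row_even (by decide) (by decide) (by decide))
  · exact mem_one 0 10 (by decide) (lower_entry_mul_lower2 (by decide) (by decide) (by decide)
      (by decide))
  · exact mem_one 1 10 (by decide) (lower_entry_mul_lower1 (by decide) (by decide) (by decide)
      (by decide))
  · exact mem_one 2 10 (by decide) (lower_entry_mul_lower2_same (by decide) (by decide) (by decide)
      (by decide))
  · exact mem_one 3 10 (by decide) (lower_entry_mul_lower1_same (by decide) (by decide) (by decide)
      (by decide))
  · exact mem_one 4 10 (by decide) (lower_entry_mul_lower2 (by decide) (by decide) (by decide)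
      (by decide))
  · exact mem_one 5 10 (by decide) (lower_entry_mul_lower1 (by decide) (by decide) (by decide)
      (by decide))
  · exact mem_one 6 10 (by decide) (one_smul_eq (commute_upper_lower (by decide) (by decide)
      (by decide) (by decide) (by decide)).eq)
  · exact mem_one 7 10 (by decide) (one_smul_eq (commute_upper_lower (by decide) (by decide)
      (by decide) (by decide) (by decide)).eq)
  · exact mem_one 8 10 (by decide) (one_smul_eq (commute_upper_lower (by decide) (by decide)
      (by decide) (by decide) (by decide)).eq)
  · exact mem_one 9 10 (by decide) (one_smul_eq (commute_upper_lower (by decide) (by decide)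
      (by decide) (by decide) (by decide)).eq)
  · exact mem_one 0 11 (by decide) (lower_entry_mul_lower2 (by decide) (by decide) (by decide)
      (by decide))
  · exact mem_one 1 11 (by decide) (lower_entry_mul_lower1 (by decide) (by decide) (by decide)
      (by decide))
  · exact mem_one 2 11 (by decide) (lower_entry_mul_lower2_same (by decide) (by decide) (by decide)
      (by decide))
  · exact mem_one 3 11 (by decide) (lower_entry_mul_lower1_same (by decide) (by decide) (by decide)
      (by decide))
  · exact mem_one 4 11 (by decide) (lower_entry_mul_lower2 (by decide) (by decide) (by decide)
      (by decide))
  · exact mem_one 5 11 (by decide) (lower_entry_mul_lower1 (by decide) (by decide) (by decide)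
      (by decide))
  · exact mem_one 6 11 (by decide) (one_smul_eq (commute_upper_lower (by decide) (by decide)
      (by decide) (by decide) (by decide)).eq)
  · exact mem_one 7 11 (by decide) (one_smul_eq (commute_upper_lower (by decide) (by decide)
      (by decide) (by decide) (by decide)).eq)
  · exact mem_one 8 11 (by decide) (one_smul_eq (commute_upper_lower (by decide) (by decide)
      (by decide) (by decide) (by decide)).eq)
  · exact mem_one 9 11 (by decide) (one_smul_eq (commute_upper_lower (by decide) (by decide)
      (by decide) (by decide) (by decide)).eq)
  · exact mem_one 10 11 (by decide) (a_row_even (by decide) (by decide) (by decide))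
  · exact mem_one 0 12 (by decide) (lower_entry_mul_lower2 (by decide) (by decide) (by decide)
      (by decide))
  · exact mem_one 1 12 (by decide) (lower_entry_mul_lower1 (by decide) (by decide) (by decide)
      (by decide))
  · exact mem_two 2 12 4 10 (by decide) (by decide) (lower_entry_mul_lower2_above (by decide)
      (by decide) (by decide) (by decide))
  · exact mem_two 3 12 5 10 (by decide) (by decide) (lower_entry_mul_lower1_above (by decide)
      (by decide) (by decide) (by decide))
  · exact mem_one 4 12 (by decide) (lower_entry_mul_lower2_same (by decide) (by decide) (by decide)
      (by decide))
  · exact mem_one 5 12 (by decide) (lower_entry_mul_lower1_same (by decide) (by decide) (by decide)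
      (by decide))
  · exact mem_one 6 12 (by decide) (one_smul_eq (commute_upper_lower (by decide) (by decide)
      (by decide) (by decide) (by decide)).eq)
  · exact mem_one 7 12 (by decide) (one_smul_eq (commute_upper_lower (by decide) (by decide)
      (by decide) (by decide) (by decide)).eq)
  · exact mem_one 8 12 (by decide) (one_smul_eq (commute_upper_lower (by decide) (by decide)
      (by decide) (by decide) (by decide)).eq)
  · exact mem_one 9 12 (by decide) (one_smul_eq (commute_upper_lower (by decide) (by decide)
      (by decide) (by decide) (by decide)).eq)
  · exact mem_one 10 12 (by decide) (a_col_even (by decide) (by decide) (by decide))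
  · exact mem_one 11 12 (by decide) (one_smul_eq (a_anti_even (by decide) (by decide) (Or.inr
      (by decide))))
  · exact mem_one 0 13 (by decide) (lower_entry_mul_lower2 (by decide) (by decide) (by decide)
      (by decide))
  · exact mem_one 1 13 (by decide) (lower_entry_mul_lower1 (by decide) (by decide) (by decide)
      (by decide))
  · exact mem_two 2 13 4 11 (by decide) (by decide) (lower_entry_mul_lower2_above (by decide)
      (by decide) (by decide) (by decide))
  · exact mem_two 3 13 5 11 (by decide) (by decide) (lower_entry_mul_lower1_above (by decide)
      (by decide) (by decide) (by decide))
  · exact mem_one 4 13 (by decide) (lower_entry_mul_lower2_same (by decide) (by decide) (by decide)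
      (by decide))
  · exact mem_one 5 13 (by decide) (lower_entry_mul_lower1_same (by decide) (by decide) (by decide)
      (by decide))
  · exact mem_one 6 13 (by decide) (one_smul_eq (commute_upper_lower (by decide) (by decide)
      (by decide) (by decide) (by decide)).eq)
  · exact mem_one 7 13 (by decide) (one_smul_eq (commute_upper_lower (by decide) (by decide)
      (by decide) (by decide) (by decide)).eq)
  · exact mem_one 8 13 (by decide) (one_smul_eq (commute_upper_lower (by decide) (by decide)
      (by decide) (by decide) (by decide)).eq)
  · exact mem_one 9 13 (by decide) (one_smul_eq (commute_upper_lower (by decide) (by decide)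
      (by decide) (by decide) (by decide)).eq)
  · exact mem_two 10 13 11 12 (by decide) (by decide) (upper_main (by decide) (by decide)
      (by decide))
  · exact mem_one 11 13 (by decide) (a_col_even (by decide) (by decide) (by decide))
  · exact mem_one 12 13 (by decide) (a_row_even (by decide) (by decide) (by decide))

theorem gen_zero_sq : gen 0 * gen 0 = 0 := lower2_odd_sq

theorem gen_one_sq : gen 1 * gen 1 = 0 := lower1_odd_sq

theorem ofFn_prod_eq_zero {n : ℕ} {B : Type*} [Ring B] (g : Fin n → B) (e : Fin n → ℕ) (i : Fin n)
    (h : g i * g i = 0) (hi : ¬ e i ≤ 1) : (List.ofFn fun j => g j ^ e j).prod = 0 := by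
  apply List.prod_eq_zero
  rw [List.mem_ofFn]
  refine ⟨i, ?_⟩
  obtain ⟨m, hm⟩ := Nat.exists_eq_add_of_le (not_le.1 hi)
  rw [hm, show 1 + 1 + m = 2 + m by ring, pow_add, pow_two, h, zero_mul]

/-- The ordered monomials span the algebra of the quantum super Poincaré group. -/
theorem span_monomial :
    Submodule.span Cq (Set.range monomial) = Subalgebra.toSubmodule OqP := by
  apply le_antisymm
  · rw [Submodule.span_le]
    rintro _ ⟨e, rfl⟩
    refine Subalgebra.list_prod_mem _ fun x hx => ?_
    obtain ⟨i, rfl⟩ := List.mem_ofFn.1 hx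
    exact Subalgebra.pow_mem _ (Algebra.subset_adjoin (Set.mem_range_self i)) _
  · refine (adjoin_le_span_ordered gen gen_mul_gen_mem_earlier).trans (Submodule.span_le.2 ?_)
    rintro _ ⟨e, rfl⟩
    rw [SetLike.mem_coe]
    -- Straightening yields arbitrary exponents; those above `1` on an odd generator give zero.
    by_cases h0 : e 0 ≤ 1
    · by_cases h1 : e 1 ≤ 1
      · exact Submodule.subset_span ⟨⟨e, h0, h1⟩, rfl⟩
      · beta_reduce
        rw [ofFn_prod_eq_zero gen e 1 gen_one_sq h1]
        exact zero_mem _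
    · beta_reduce
      rw [ofFn_prod_eq_zero gen e 0 gen_zero_sq h0]
      exact zero_mem _

end
end QuantumPoincare

namespace QuantumPoincare

noncomputable section

/-! ### Matrices satisfying the exchange relation -/

section Exchange

variable {R : Type*} [Ring R] [Algebra Cq R]

/-- The coefficients of the flip in the `R`-matrix. -/
def flipCoeff (i k : Fin 5) : Cq :=
  if i = k then (if i = 4 then -qpow 1 else qpow (-1)) else 1

/-- The off-diagonal coefficients of the `R`-matrix. -/
def stayCoeff (i k : Fin 5) : Cq := if i < k then qpow (-1) - qpow 1 else 0

theorem flipCoeff_comm (i k : Fin 5) : flipCoeff i k = flipCoeff k i := by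
  simp only [flipCoeff, eq_comm (a := i)]
  split_ifs with h <;> simp_all

/-- The exchange relation `R A₁ A₂ = A₂ A₁ R`. -/
def Exchange (A : Matrix (Fin 5) (Fin 5) R) : Prop :=
  ∀ i k j l, flipCoeff i k • (A k j * A i l) + stayCoeff i k • (A i j * A k l) =
    flipCoeff j l • (A i l * A k j) + stayCoeff j l • (A i j * A k l)

theorem Exchange.transpose {A : Matrix (Fin 5) (Fin 5) R} (hA : Exchange A) :
    Exchange A.transpose := fun i k j l => (hA j l i k).symm

/-- This is the compatibility of the coproduct with the exchange relation: the `R`-matrix is carried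
first past `A`, then past `B`. The entries commute without signs, so no graded tensor product is
needed. -/
theorem Exchange.mul {A B : Matrix (Fin 5) (Fin 5) R} (hA : Exchange A) (hB : Exchange B)
    (hAB : ∀ i j k l, Commute (B i j) (A k l)) : Exchange (A * B) := by
  intro i k j l
  have h : ∀ i' k' j' l', (A * B) i' j' * (A * B) k' l' =
      ∑ s, ∑ t, A i' s * A k' t * (B s j' * B t l') := by
    intro i' k' j' l'
    rw [Matrix.mul_apply, Matrix.mul_apply, Finset.sum_mul_sum]
    refine Finset.sum_congr rfl fun s _ => Finset.sum_congr rfl fun t _ => ?_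
    rw [mul_assoc, ← mul_assoc (B s j'), (hAB s j' k' t).eq]
    simp only [mul_assoc]
  -- The flip term is carried from `A` to `B` by interchanging the summation indices, which is
  -- possible because `flipCoeff` is symmetric.
  have hswap : ∑ s, ∑ t, flipCoeff s t • (A i t * A k s) * (B s j * B t l) =
      ∑ s, ∑ t, A i s * A k t * (flipCoeff s t • (B t j * B s l)) := by
    rw [Finset.sum_comm]
    refine Finset.sum_congr rfl fun s _ => Finset.sum_congr rfl fun t _ => ?_
    rw [flipCoeff_comm, smul_mul_assoc, mul_smul_comm]
  calc flipCoeff i k • ((A * B) k j * (A * B) i l) + stayCoeff i k • ((A * B) i j * (A * B) k l)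
      = ∑ s, ∑ t, (flipCoeff i k • (A k s * A i t) + stayCoeff i k • (A i s * A k t)) *
          (B s j * B t l) := by
        simp only [h, Finset.smul_sum, ← Finset.sum_add_distrib, add_mul, smul_mul_assoc]
    _ = ∑ s, ∑ t, flipCoeff s t • (A i t * A k s) * (B s j * B t l) +
          ∑ s, ∑ t, stayCoeff s t • (A i s * A k t) * (B s j * B t l) := by
        simp only [hA i k, add_mul, Finset.sum_add_distrib]
    _ = ∑ s, ∑ t, A i s * A k t *
          (flipCoeff s t • (B t j * B s l) + stayCoeff s t • (B s j * B t l)) := by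
        rw [hswap]
        simp only [mul_add, Finset.sum_add_distrib, smul_mul_assoc, mul_smul_comm]
    _ = flipCoeff j l • ((A * B) i l * (A * B) k j) +
          stayCoeff j l • ((A * B) i j * (A * B) k l) := by
        simp only [hB _ _ j l, h, Finset.smul_sum, ← Finset.sum_add_distrib, mul_add,
          mul_smul_comm]

variable {A : Matrix (Fin 5) (Fin 5) R}

theorem Exchange.row_even (hA : Exchange A) {i j l : Fin 5} (hi : i ≠ 4) (h : j < l) :
    A i l * A i j = qpow 1 • (A i j * A i l) := by
  have := hA i i j l
  simp only [flipCoeff, stayCoeff, hi, h, h.ne, if_true, if_false, lt_irrefl, one_smul, zero_smul,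
    add_zero] at this
  rw [← sub_eq_iff_eq_add] at this
  rw [← this]
  module

theorem Exchange.row_odd (hA : Exchange A) {j l : Fin 5} (h : j < l) :
    A 4 l * A 4 j = -qpow (-1) • (A 4 j * A 4 l) := by
  have := hA 4 4 j l
  simp only [flipCoeff, stayCoeff, h, h.ne, if_true, if_false, lt_irrefl, one_smul, zero_smul,
    add_zero] at this
  rw [← sub_eq_iff_eq_add] at this
  rw [← this]
  module

theorem Exchange.col_even (hA : Exchange A) {i k j : Fin 5} (hj : j ≠ 4) (h : i < k) :
    A k j * A i j = qpow 1 • (A i j * A k j) :=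
  hA.transpose.row_even hj h

theorem Exchange.anti (hA : Exchange A) {i j k l : Fin 5} (hik : i < k) (hlj : j < l) :
    A k j * A i l = A i l * A k j := by
  have := hA i k j l
  simpa only [flipCoeff, stayCoeff, hik, hik.ne, hlj, hlj.ne, if_true, if_false, one_smul,
    add_left_inj] using this

theorem Exchange.main (hA : Exchange A) {i j k l : Fin 5} (hik : i < k) (hlj : j < l) :
    A k l * A i j = A i j * A k l - (qpow (-1) - qpow 1) • (A i l * A k j) := by
  have := hA i k l j
  simp only [flipCoeff, stayCoeff, hik, hik.ne, hlj.not_gt, hlj.ne', if_true, if_false, one_smul,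
    zero_smul, add_zero] at this
  rw [← this, add_sub_cancel_right]

/-- With both rows equal to the odd one and equal even columns, the relation reads `-q A² = q⁻¹ A²`,
and `q + q⁻¹` is cancelled. -/
theorem Exchange.odd_sq (hA : Exchange A)
    (hR : ∀ x : R, (qpow (-1) + qpow 1) • x = 0 → x = 0) {j : Fin 5} (hj : j ≠ 4) :
    A 4 j * A 4 j = 0 := by
  have := hA 4 4 j j
  simp only [flipCoeff, stayCoeff, hj, if_true, if_false, lt_irrefl, zero_smul, add_zero] at this
  apply hR
  rw [add_smul, ← this, neg_smul, neg_add_cancel]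

/-- The quantum minor of the rows and columns `i` and `j`. -/
def blockMinor (A : Matrix (Fin 5) (Fin 5) R) (i j : Fin 5) : R :=
  A i i * A j j - qpow (-1) • (A i j * A j i)

/-- Multiplicativity of the 2 × 2 quantum determinant. The hypothesis `h` says that the intermediate
summation index stays in the block, which the zero blocks of triangular matrices guarantee. -/
theorem Exchange.blockMinor_mul {B : Matrix (Fin 5) (Fin 5) R} (hB : Exchange B)
    (hAB : ∀ i j k l, Commute (B i j) (A k l)) {i k : Fin 5} (hik : i < k) (hk : k ≠ 4)
    (h : ∀ s t, (s = i ∨ s = k) → (t = i ∨ t = k) → (A * B) s t = A s i * B i t + A s k * B k t) :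
    blockMinor (A * B) i k = blockMinor A i k * blockMinor B i k := by
  have hi : i ≠ 4 := by omega
  rw [blockMinor, h i i (.inl rfl) (.inl rfl), h k k (.inr rfl) (.inr rfl),
    h i k (.inl rfl) (.inr rfl), h k i (.inr rfl) (.inl rfl)]
  have r1 := hB.row_even hi hik
  have r2 := hB.row_even hk hik
  have r3 := hB.anti hik hik
  have r4 := hB.main hik hik
  have c := fun s t u v => (hAB s t u v).eq
  have c' := fun s t u v => left_reassoc (c s t u v)
  simp only [blockMinor, mul_add, add_mul, mul_sub, sub_mul, smul_add, smul_sub, mul_assoc,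
    mul_smul_comm, smul_mul_assoc, c', r1, r2, r3, r4]
  have hpq := qpow_neg_mul_qpow
  match_scalars <;> grind

/-- Block lower triangular matrices satisfying the exchange relation, with invertible quantum
determinants of the diagonal blocks of sizes `2`, `2` and `1`. -/
structure BlockLower (A : Matrix (Fin 5) (Fin 5) R) : Prop where
  exchange : Exchange A
  zero_upper : ∀ i j, i < 2 → 2 ≤ j → A i j = 0
  zero_last : ∀ i, i < 4 → A i 4 = 0
  isUnit_upper : IsUnit (blockMinor A 0 1)
  isUnit_lower : IsUnit (blockMinor A 2 3)
  isUnit_last : IsUnit (A 4 4)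

theorem BlockLower.mul {B : Matrix (Fin 5) (Fin 5) R} (hA : BlockLower A) (hB : BlockLower B)
    (hAB : ∀ i j k l, Commute (B i j) (A k l)) : BlockLower (A * B) where
  exchange := hA.exchange.mul hB.exchange hAB
  zero_upper i j hi hj := by
    simp [Matrix.mul_apply, Fin.sum_univ_five, hA.zero_upper i _ hi, hB.zero_upper _ j _ hj]
  zero_last i hi := by
    simp [Matrix.mul_apply, Fin.sum_univ_five, hA.zero_last i hi, hB.zero_last]
  isUnit_upper := by
    rw [hB.exchange.blockMinor_mul hAB (by decide) (by decide)]
    · exact hA.isUnit_upper.mul hB.isUnit_upper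
    · intro s t hs _
      have hs' : s < 2 := by omega
      simp [Matrix.mul_apply, Fin.sum_univ_five, hA.zero_upper s _ hs']
  isUnit_lower := by
    rw [hB.exchange.blockMinor_mul hAB (by decide) (by decide)]
    · exact hA.isUnit_lower.mul hB.isUnit_lower
    · intro s t hs ht
      have hs' : s < 4 := by omega
      have ht' : 2 ≤ t := by omega
      simp [Matrix.mul_apply, Fin.sum_univ_five, hA.zero_last s hs', hB.zero_upper _ t _ ht']
  isUnit_last := by
    have : (A * B) 4 4 = A 4 4 * B 4 4 := by
      simp [Matrix.mul_apply, Fin.sum_univ_five, hB.zero_last]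
    rw [this]
    exact hA.isUnit_last.mul hB.isUnit_last

end Exchange

end
end QuantumPoincare

namespace QuantumPoincare

noncomputable section

/-! ### Homomorphisms from the parabolic -/

section Lift

variable {R : Type*} [Ring R] [Algebra Cq R]

/-- The matrix `A` with its last entry multiplied by `σ`. -/
def twist (A : Matrix (Fin 5) (Fin 5) R) (σ : R) (i j : Fin 5) : R :=
  if i = 4 ∧ j = 4 then A 4 4 * σ else A i j

/-- The data that define a homomorphism from the parabolic to `R`. -/
structure ParModel (A : Matrix (Fin 5) (Fin 5) R) (σ : R) : Prop where
  blockLower : BlockLower A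
  sq : σ * σ = 1
  comm : ∀ i j, i ≠ 4 → Commute σ (A i j)
  anticomm : ∀ j, j ≠ 4 → A 4 j * σ = -(σ * A 4 j)
  torsion : ∀ x : R, (qpow (-1) + qpow 1) • x = 0 → x = 0

variable {A : Matrix (Fin 5) (Fin 5) R} {σ : R}

set_option linter.unusedSectionVars false

theorem twist_left {i j : Fin 5} (h : i ≠ 4) : twist A σ i j = A i j := by simp [twist, h]

theorem twist_right {i j : Fin 5} (h : j ≠ 4) : twist A σ i j = A i j := by simp [twist, h]

theorem twist_last : twist A σ 4 4 = A 4 4 * σ := by simp [twist]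

theorem parity_odd_left {j : Fin 5} (hj : j ≠ 4) : parity 4 j = 1 := by
  simp [parity, par, hj]

theorem parity_last : parity 4 4 = 0 := by decide

theorem par_even {i : Fin 5} (h : i ≠ 4) : par i = 0 := by simp [par, h]

theorem par_odd : par 4 = 1 := rfl

theorem eq_qpow_neg_smul {M : Type*} [AddCommGroup M] [Module Cq M] {x y : M}
    (h : y = qpow 1 • x) : x = qpow (-1) • y := by
  rw [h, smul_smul, qpow_neg_mul_qpow, one_smul]

theorem qpow_par_even {i : Fin 5} (h : i ≠ 4) : qpow ((-1) ^ (par i + 1)) = qpow (-1) := by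
  simp [par_even h]

theorem qpow_par_odd : qpow ((-1) ^ (par 4 + 1)) = qpow 1 := by
  simp [par_odd]

theorem ParModel.twist_zero (h : ParModel A σ) {i : Fin 5} (hi : i ≠ 4) : twist A σ i 4 = 0 := by
  rw [twist_left hi, h.blockLower.zero_last i (by omega)]

theorem ParModel.odd_sq (h : ParModel A σ) (i j : Fin 5) (hij : parity i j = 1) :
    twist A σ i j * twist A σ i j = 0 := by
  by_cases hj : j = 4
  · subst hj
    have hi : i ≠ 4 := by rintro rfl; exact absurd hij (by decide)
    rw [h.twist_zero hi, zero_mul]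
  · by_cases hi : i = 4
    · subst hi
      rw [twist_right hj]
      exact h.blockLower.exchange.odd_sq h.torsion hj
    · rw [parity_even hi hj] at hij
      exact absurd hij (by decide)

/-- In row 5 the unsigned exchange relation has the factor `-q` throughout. That is the super
relation between two odd entries, but `a₅₅` is even and requires `q`; the anticommutation of `σ`
with the odd entries repairs this sign. -/
theorem ParModel.row (h : ParModel A σ) (i j l : Fin 5) (hjl : j < l) :
    twist A σ i j * twist A σ i l =
      (sgn (parity i j * parity i l) * qpow ((-1) ^ (par i + 1))) •
        (twist A σ i l * twist A σ i j) := by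
  have hj : j ≠ 4 := by omega
  by_cases hi : i = 4
  · subst hi
    have h1 : A 4 j * A 4 l = -qpow 1 • (A 4 l * A 4 j) := by
      rw [h.blockLower.exchange.row_odd hjl, smul_smul, neg_mul_neg, qpow_mul_qpow_neg, one_smul]
    rw [qpow_par_odd, parity_odd_left hj, twist_right hj]
    by_cases hl : l = 4
    · subst hl
      have h2 : σ * A 4 j = -(A 4 j * σ) := by rw [h.anticomm j hj, neg_neg]
      rw [parity_last, twist_last, ← mul_assoc, h1, mul_assoc (A 4 4), h2]
      simp [sgn, mul_assoc]
    · rw [parity_odd_left hl, twist_right hl, h1]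
      simp [sgn]
  · by_cases hl : l = 4
    · subst hl
      simp [h.twist_zero hi]
    · rw [twist_left hi, twist_left hi, parity_even hi hj, qpow_par_even hi]
      simpa [sgn] using eq_qpow_neg_smul (h.blockLower.exchange.row_even hi hjl)

theorem ParModel.col (h : ParModel A σ) (i k j : Fin 5) (hik : i < k) :
    twist A σ i j * twist A σ k j =
      (sgn (parity i j * parity k j) * qpow ((-1) ^ (par j + 1))) •
        (twist A σ k j * twist A σ i j) := by
  have hi : i ≠ 4 := by omega
  by_cases hj : j = 4
  · subst hj
    simp [h.twist_zero hi]
  · rw [twist_right hj, twist_right hj, parity_even hi hj, qpow_par_even hj]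
    simpa [sgn] using eq_qpow_neg_smul (h.blockLower.exchange.col_even hj hik)

theorem ParModel.anti (h : ParModel A σ) (i j k l : Fin 5)
    (hij : (i < k ∧ l < j) ∨ (k < i ∧ j < l)) :
    twist A σ i j * twist A σ k l =
      sgn (parity i j * parity k l) • (twist A σ k l * twist A σ i j) := by
  rcases hij with ⟨hik, hlj⟩ | ⟨hki, hjl⟩
  · have hi : i ≠ 4 := by omega
    have hl : l ≠ 4 := by omega
    by_cases hj : j = 4
    · subst hj
      simp [h.twist_zero hi]
    · rw [twist_right hj, twist_right hl, parity_even hi hj,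
        h.blockLower.exchange.anti hik hlj]
      simp [sgn]
  · have hk : k ≠ 4 := by omega
    have hj : j ≠ 4 := by omega
    by_cases hl : l = 4
    · subst hl
      simp [h.twist_zero hk]
    · rw [twist_right hj, twist_right hl, parity_even hk hl,
        h.blockLower.exchange.anti hki hjl]
      simp [sgn]

theorem ParModel.main (h : ParModel A σ) (i j k l : Fin 5) (hik : i < k) (hjl : j < l) :
    twist A σ i j * twist A σ k l -
        sgn (parity i j * parity k l) • (twist A σ k l * twist A σ i j) =
      (sgn (parity i j * parity k j) * (qpow (-1) - qpow 1)) •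
        (twist A σ k j * twist A σ i l) := by
  have hi : i ≠ 4 := by omega
  have hj : j ≠ 4 := by omega
  have hm := h.blockLower.exchange.main hik hjl
  rw [parity_even hi hj, twist_right hj, twist_right hj, twist_left hi]
  by_cases hl : l = 4
  · subst hl
    rw [h.blockLower.zero_last i (by omega)] at hm ⊢
    by_cases hk : k = 4
    · subst hk
      rw [zero_mul, smul_zero, sub_zero] at hm
      rw [twist_last, mul_assoc, (h.comm i j hi).eq, ← mul_assoc, ← mul_assoc, hm]
      simp [sgn]
    · simp [h.twist_zero hk]
  · rw [twist_right hl, hm, h.blockLower.exchange.anti hik hjl]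
    simp [sgn]

theorem ParModel.isUnit_sigma (h : ParModel A σ) : IsUnit σ := ⟨⟨σ, σ, h.sq, h.sq⟩, rfl⟩

/-- The homomorphism from the free algebra. -/
def ParModel.freeLift (_ : ParModel A σ) : FreeGL →ₐ[Cq] R :=
  FreeAlgebra.lift Cq fun x => match x with
    | .entry i j => twist A σ i j
    | .invDetEven => Ring.inverse (blockMinor A 0 1 * blockMinor A 2 3)
    | .invDetOdd => Ring.inverse (A 4 4 * σ)

theorem ParModel.freeLift_fa (h : ParModel A σ) (i j : Fin 5) :
    h.freeLift (fa i j) = twist A σ i j :=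
  FreeAlgebra.lift_ι_apply _ _

theorem ParModel.freeLift_invDetEven (h : ParModel A σ) :
    h.freeLift (FreeAlgebra.ι Cq .invDetEven) =
      Ring.inverse (blockMinor A 0 1 * blockMinor A 2 3) :=
  FreeAlgebra.lift_ι_apply _ _

theorem ParModel.freeLift_invDetOdd (h : ParModel A σ) :
    h.freeLift (FreeAlgebra.ι Cq .invDetOdd) = Ring.inverse (A 4 4 * σ) :=
  FreeAlgebra.lift_ι_apply _ _

theorem ParModel.freeLift_detEven (h : ParModel A σ) :
    h.freeLift detEven = blockMinor A 0 1 * blockMinor A 2 3 := by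
  rw [map_detEven]
  · simp only [h.freeLift_fa]
    rfl
  · intro i j hi hj
    rw [h.freeLift_fa, twist_left (by omega), h.blockLower.zero_upper i j hi hj]

theorem ParModel.freeLift_rel (h : ParModel A σ) {u v : FreeGL} (huv : GLRel u v) :
    h.freeLift u = h.freeLift v := by
  have hu := h.blockLower.isUnit_upper.mul h.blockLower.isUnit_lower
  have hu' := h.blockLower.isUnit_last.mul h.isUnit_sigma
  cases huv with
  | odd_sq i j hij => simpa [h.freeLift_fa] using h.odd_sq i j hij
  | row i j l hjl => simpa [h.freeLift_fa] using h.row i j l hjl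
  | col i k j hik => simpa [h.freeLift_fa] using h.col i k j hik
  | anti i j k l hij => simpa [h.freeLift_fa] using h.anti i j k l hij
  | main i j k l hik hjl => simpa [h.freeLift_fa] using h.main i j k l hik hjl
  | detEven_inv =>
    rw [map_mul, map_one, h.freeLift_detEven, h.freeLift_invDetEven, Ring.mul_inverse_cancel _ hu]
  | inv_detEven =>
    rw [map_mul, map_one, h.freeLift_detEven, h.freeLift_invDetEven, Ring.inverse_mul_cancel _ hu]
  | detOdd_inv =>
    rw [map_mul, map_one, h.freeLift_fa, twist_last, h.freeLift_invDetOdd,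
      Ring.mul_inverse_cancel _ hu']
  | inv_detOdd =>
    rw [map_mul, map_one, h.freeLift_fa, twist_last, h.freeLift_invDetOdd,
      Ring.inverse_mul_cancel _ hu']

/-- The homomorphism from the algebra of the general linear supergroup. -/
def ParModel.liftGL (h : ParModel A σ) : OGL →ₐ[Cq] R :=
  RingQuot.liftAlgHom Cq ⟨h.freeLift, fun _ _ => h.freeLift_rel⟩

theorem ParModel.liftGL_g (h : ParModel A σ) (i j : Fin 5) : h.liftGL (g i j) = twist A σ i j :=
  (RingQuot.liftAlgHom_mkAlgHom_apply Cq _ _ _).trans (h.freeLift_fa i j)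

/-- The homomorphism from the algebra of the parabolic. -/
def ParModel.lift (h : ParModel A σ) : OPar →ₐ[Cq] R :=
  RingQuot.liftAlgHom Cq ⟨h.liftGL, by
    rintro _ _ ⟨i, j, hi, hj⟩
    rw [h.liftGL_g, map_zero, twist_left (by omega), h.blockLower.zero_upper i j hi hj]⟩

theorem ParModel.lift_a (h : ParModel A σ) (i j : Fin 5) : h.lift (a i j) = twist A σ i j :=
  (RingQuot.liftAlgHom_mkAlgHom_apply Cq _ _ _).trans (h.liftGL_g i j)

end Lift

end
end QuantumPoincare

namespace QuantumPoincare

noncomputable section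

/-! ### Elementary matrices -/

section Elementary

set_option linter.unusedSectionVars false
set_option linter.unusedSimpArgs false

variable {R : Type*} [Ring R] [Algebra Cq R]

/-- The matrix that differs from the identity in the diagonal block of size two that starts at `s`,
which is lower triangular. -/
def elementary (s : Fin 4) (α ξ δ : R) : Matrix (Fin 5) (Fin 5) R := fun i j =>
  if i = j then (if i = s.castSucc then α else if i = s.succ then δ else 1)
  else if i = s.succ ∧ j = s.castSucc then ξ else 0

/-- No index lies strictly between two adjacent ones, so an outside index compares in the same way
with both indices of the block. -/
theorem stayCoeff_eq_of_adjacent {s : Fin 4} {i k l : Fin 5}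
    (hi : ¬ (i = s.castSucc ∨ i = s.succ)) (hk : k = s.castSucc ∨ k = s.succ)
    (hl : l = s.castSucc ∨ l = s.succ) :
    stayCoeff i k = stayCoeff i l ∧ stayCoeff k i = stayCoeff l i := by
  have h1 : i < k ↔ i < l := by
    simp only [Fin.ext_iff, Fin.lt_def, Fin.val_castSucc, Fin.val_succ] at *
    omega
  have h2 : k < i ↔ l < i := by
    simp only [Fin.ext_iff, Fin.lt_def, Fin.val_castSucc, Fin.val_succ] at *
    omega
  simp only [stayCoeff, h1, h2, and_self]

theorem flipCoeff_of_ne {i k : Fin 5} (h : i ≠ k) : flipCoeff i k = 1 := by simp [flipCoeff, h]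

theorem elementary_of_not {s : Fin 4} (α ξ δ : R) {i j : Fin 5}
    (h : ¬ ((i = s.castSucc ∨ i = s.succ) ∧ (j = s.castSucc ∨ j = s.succ))) :
    elementary s α ξ δ i j = if i = j then 1 else 0 := by
  simp only [elementary]
  grind

/-- With all four indices in the block, the relation reduces to the hypotheses, which are those of a
triangular 2 × 2 quantum matrix. If some index lies outside, its row and column are those of the
identity matrix, and the terms cancel by comparing coefficients. -/
theorem exchange_elementary (s : Fin 4) {α ξ δ : R} (h1 : ξ * α = qpow 1 • (α * ξ))
    (h2 : δ * ξ = (if s = 3 then -qpow (-1) else qpow 1) • (ξ * δ)) (h3 : δ * α = α * δ)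
    (h4 : s = 3 → ξ * ξ = 0) : Exchange (elementary s α ξ δ) := by
  intro i k j l
  have key := fun {i j : Fin 5} => elementary_of_not (s := s) α ξ δ (i := i) (j := j)
  by_cases hi : i = s.castSucc ∨ i = s.succ
  · by_cases hk : k = s.castSucc ∨ k = s.succ
    · by_cases hj : j = s.castSucc ∨ j = s.succ
      · by_cases hl : l = s.castSucc ∨ l = s.succ
        · have := qpow_neg_mul_qpow
          fin_cases s <;> simp at h2 h4 hi hj hk hl <;>
          rcases hi with rfl | rfl <;> rcases hk with rfl | rfl <;> rcases hj with rfl | rfl <;>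
            rcases hl with rfl | rfl <;> simp [elementary, flipCoeff, stayCoeff, *] <;>
            (try simp only [smul_smul]) <;> try (match_scalars <;> grind)
        · rw [key (i := i) (j := l) (by tauto), key (i := k) (j := l) (by tauto),
            if_neg (by grind), if_neg (by grind)]
          simp
      · rw [key (i := i) (j := j) (by tauto), key (i := k) (j := j) (by tauto),
          if_neg (by grind), if_neg (by grind)]
        simp
    · rw [key (i := k) (j := j) (by tauto), key (i := k) (j := l) (by tauto)]
      by_cases hj : k = j
      · subst hj
        by_cases hl : k = l
        · subst hl
          have hik : i ≠ k := by grind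
          simp [key (i := i) (j := k) (by tauto), hik]
        · rw [flipCoeff_of_ne (by grind), flipCoeff_of_ne hl]
          simp [hl]
      · by_cases hl : k = l
        · subst hl
          by_cases hj' : j = s.castSucc ∨ j = s.succ
          · rw [(stayCoeff_eq_of_adjacent hk hi hj').2]
            simp [hj]
          · have hij : i ≠ j := by grind
            simp [key (i := i) (j := j) (by tauto), hij, hj]
        · simp [hj, hl]
  · rw [key (i := i) (j := j) (by tauto), key (i := i) (j := l) (by tauto)]
    by_cases hj : i = j
    · subst hj
      by_cases hki : k = i
      · subst hki
        rw [key (i := k) (j := k) (by tauto), key (i := k) (j := l) (by tauto)]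
        by_cases hl : k = l <;> simp [hl]
      · by_cases hl : i = l
        · subst hl
          rw [key (i := k) (j := i) (by tauto), if_neg hki]
          simp
        · rw [key (i := k) (j := i) (by tauto), if_neg hki]
          by_cases hkl : (k = s.castSucc ∨ k = s.succ) ∧ (l = s.castSucc ∨ l = s.succ)
          · rw [(stayCoeff_eq_of_adjacent hi hkl.1 hkl.2).1]
            simp
          · rw [key (i := k) (j := l) hkl]
            by_cases h : k = l <;> simp [h]
    · by_cases hl : i = l
      · subst hl
        by_cases hki : k = i
        · subst hki
          rw [key (i := k) (j := j) (by tauto), if_neg hj]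
          simp
        · rw [flipCoeff_of_ne (Ne.symm hki), flipCoeff_of_ne (Ne.symm hj)]
          simp [hj]
      · simp [hj, hl]

theorem exchange_diagonal {d : Fin 5 → R} (h : ∀ i j, Commute (d i) (d j)) :
    Exchange (Matrix.diagonal d) := by
  intro i k j l
  simp only [Matrix.diagonal_apply]
  by_cases hkj : k = j
  · subst hkj
    by_cases hil : i = l
    · subst hil
      by_cases hik : i = k
      · subst hik; simp
      · have hki : k ≠ i := Ne.symm hik
        simp [hik, hki, flipCoeff, (h i k).eq]
    · by_cases hik : i = k
      · subst hik; simp [hil]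
      · simp [hik, hil]
  · by_cases hij : i = j
    · subst hij
      by_cases hkl : k = l
      · subst hkl
        simp [hkj]
      · simp [hkj, hkl]
    · simp [hkj, hij]

theorem blockLower_diagonal {d : Fin 5 → R} (h : ∀ i j, Commute (d i) (d j))
    (hd : ∀ i, IsUnit (d i)) : BlockLower (Matrix.diagonal d) where
  exchange := exchange_diagonal h
  zero_upper i j hi hj := Matrix.diagonal_apply_ne _ (by omega)
  zero_last i hi := Matrix.diagonal_apply_ne _ (by omega)
  isUnit_upper := by simpa [blockMinor] using (hd 0).mul (hd 1)
  isUnit_lower := by simpa [blockMinor] using (hd 2).mul (hd 3)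
  isUnit_last := by simpa using hd 4

theorem blockLower_elementary (s : Fin 4) {α ξ δ : R} (h1 : ξ * α = qpow 1 • (α * ξ))
    (h2 : δ * ξ = (if s = 3 then -qpow (-1) else qpow 1) • (ξ * δ)) (h3 : δ * α = α * δ)
    (h4 : s = 3 → ξ * ξ = 0) (hα : IsUnit α) (hδ : IsUnit δ) :
    BlockLower (elementary s α ξ δ) where
  exchange := exchange_elementary s h1 h2 h3 h4
  zero_upper i j hi hj := by
    rw [elementary, if_neg (by omega), if_neg]
    simp only [Fin.ext_iff, Fin.val_succ, Fin.val_castSucc]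
    omega
  zero_last i hi := by
    rw [elementary, if_neg (by omega), if_neg]
    simp only [Fin.ext_iff, Fin.val_succ, Fin.val_castSucc]
    omega
  isUnit_upper := by fin_cases s <;> simp [blockMinor, elementary, hα, hδ, hα.mul hδ]
  isUnit_lower := by fin_cases s <;> simp [blockMinor, elementary, hα, hδ, hα.mul hδ]
  isUnit_last := by fin_cases s <;> simp [elementary, hδ]

/-- The two positions are those at which an upper triangular entry falls inside the blocks `x` and
`y`. -/
theorem blockLower_elementary_transpose {s : Fin 4} (hs : s = 0 ∨ s = 2) {α ξ δ : R}
    (h1 : ξ * α = qpow 1 • (α * ξ)) (h2 : δ * ξ = qpow 1 • (ξ * δ)) (h3 : δ * α = α * δ)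
    (hα : IsUnit α) (hδ : IsUnit δ) : BlockLower (elementary s α ξ δ).transpose where
  exchange := by
    refine (exchange_elementary s h1 ?_ h3 ?_).transpose
    · rcases hs with rfl | rfl <;> simpa using h2
    · rcases hs with rfl | rfl <;> simp
  zero_upper i j hi hj := by
    rw [Matrix.transpose_apply, elementary, if_neg (by omega), if_neg]
    have hs' : s.val = 0 ∨ s.val = 2 := by rcases hs with rfl | rfl <;> simp
    simp only [Fin.ext_iff, Fin.val_succ, Fin.val_castSucc]
    omega
  zero_last i hi := by
    rw [Matrix.transpose_apply, elementary, if_neg (by omega), if_neg]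
    have hs' : s.val = 0 ∨ s.val = 2 := by rcases hs with rfl | rfl <;> simp
    simp only [Fin.ext_iff, Fin.val_succ, Fin.val_castSucc]
    omega
  isUnit_upper := by
    rcases hs with rfl | rfl <;> simp [blockMinor, elementary, hα, hδ, hα.mul hδ]
  isUnit_lower := by
    rcases hs with rfl | rfl <;> simp [blockMinor, elementary, hα, hδ, hα.mul hδ]
  isUnit_last := by rcases hs with rfl | rfl <;> simp [elementary]

end Elementary

end
end QuantumPoincare

namespace QuantumPoincare

noncomputable section

/-! ### Shift operators on a free module -/

section Shift

/-- The basis vectors of the model: exponents of thirteen even and two odd modes. -/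
abbrev Mode : Type := (Fin 13 → ℤ) × (Fin 2 → ZMod 2)

/-- The free module with basis `Mode`. -/
abbrev Fock : Type := Mode →₀ Cq

/-- The operator that maps the basis vector `m` to `c m` times the basis vector `m + v`. -/
def shift (v : Mode) (c : Mode → Cq) : Module.End Cq Fock :=
  Finsupp.linearCombination Cq fun m => Finsupp.single (m + v) (c m)

theorem shift_single (v : Mode) (c : Mode → Cq) (m : Mode) (x : Cq) :
    shift v c (Finsupp.single m x) = Finsupp.single (m + v) (x * c m) := by
  simp [shift]

theorem fock_end_ext {f g : Module.End Cq Fock}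
    (h : ∀ m, f (Finsupp.single m 1) = g (Finsupp.single m 1)) : f = g :=
  Finsupp.lhom_ext' fun m => LinearMap.ext_ring (h m)

theorem shift_mul_shift (v w : Mode) (c d : Mode → Cq) :
    shift v c * shift w d = shift (v + w) fun m => d m * c (m + w) := by
  apply fock_end_ext
  intro m
  simp [shift_single, add_assoc, add_comm w v]

theorem smul_shift (x : Cq) (v : Mode) (c : Mode → Cq) :
    x • shift v c = shift v fun m => x * c m := by
  apply fock_end_ext
  intro m
  simp [shift_single]

theorem shift_zero_one : shift 0 (fun _ => 1) = 1 := by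
  apply fock_end_ext
  intro m
  simp [shift_single]

theorem shift_zero : shift 0 (fun _ => 0) = 0 := by
  apply fock_end_ext
  intro m
  simp [shift_single]

theorem fock_end_torsion (x : Module.End Cq Fock) (h : (qpow (-1) + qpow 1) • x = 0) : x = 0 := by
  have h0 : qpow (-1) + qpow 1 ≠ 0 := by
    intro h
    have := congrArg (LaurentPolynomial.eval₂ (RingHom.id ℂ) 1) h
    simp [qpow] at this
  apply fock_end_ext
  intro m
  refine Finsupp.ext fun n => ?_
  have := DFunLike.congr_fun (LinearMap.congr_fun h (Finsupp.single m 1)) n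
  simpa [h0] using this

/-- The level of an even mode: the last four modes have the same level. -/
def evenLevel (t : Fin 13) : ℕ := min t 9

/-- The vectors that vanish at the modes of level `n`. -/
def VanishesAt (n : ℕ) (v : Mode) : Prop :=
  (∀ t, evenLevel t = n → v.1 t = 0) ∧ ∀ f : Fin 2, 10 + (f : ℕ) = n → v.2 f = 0

/-- The vectors that vanish at the modes of other levels than `n`. -/
def SupportedAt (n : ℕ) (v : Mode) : Prop :=
  (∀ t, evenLevel t ≠ n → v.1 t = 0) ∧ ∀ f : Fin 2, 10 + (f : ℕ) ≠ n → v.2 f = 0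

theorem SupportedAt.vanishesAt {n k : ℕ} (h : n ≠ k) {v : Mode} (hv : SupportedAt n v) :
    VanishesAt k v :=
  ⟨fun t ht => hv.1 t (ht ▸ h.symm), fun f hf => hv.2 f (hf ▸ h.symm)⟩

/-- The shift operators that involve only the modes of level `n`. -/
def IsLocal (n : ℕ) (P : Module.End Cq Fock) : Prop :=
  ∃ v c, P = shift v c ∧ SupportedAt n v ∧ ∀ m w, VanishesAt n w → c (m + w) = c m

theorem isLocal_one (n : ℕ) : IsLocal n 1 :=
  ⟨0, fun _ => 1, shift_zero_one.symm, ⟨fun _ _ => rfl, fun _ _ => rfl⟩, fun _ _ _ => rfl⟩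

theorem isLocal_zero (n : ℕ) : IsLocal n 0 :=
  ⟨0, fun _ => 0, shift_zero.symm, ⟨fun _ _ => rfl, fun _ _ => rfl⟩, fun _ _ _ => rfl⟩

/-- Each operator shifts only its own modes, and its coefficient does not see the shift made by the
other. -/
theorem IsLocal.commute {n k : ℕ} (h : n ≠ k) {P Q : Module.End Cq Fock} (hP : IsLocal n P)
    (hQ : IsLocal k Q) : Commute P Q := by
  obtain ⟨v, c, rfl, hv, hc⟩ := hP
  obtain ⟨w, d, rfl, hw, hd⟩ := hQ
  rw [commute_iff_eq, shift_mul_shift, shift_mul_shift, add_comm v w]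
  congr 1
  funext m
  rw [hc m w (hw.vanishesAt h.symm), hd m v (hv.vanishesAt h), mul_comm]

theorem isLocal_elementary {n : ℕ} (s : Fin 4) {α ξ δ : Module.End Cq Fock} (hα : IsLocal n α)
    (hξ : IsLocal n ξ) (hδ : IsLocal n δ) (i j : Fin 5) : IsLocal n (elementary s α ξ δ i j) := by
  rw [elementary]
  split_ifs
  exacts [hα, hδ, isLocal_one n, hξ, isLocal_zero n]

/-- The diagonal operator whose eigenvalue is a power of `q` given by an even mode. -/
def evenScale (t : Fin 13) (e : ℤ) : Module.End Cq Fock := shift 0 fun m => qpow (e * m.1 t)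

/-- The operator that raises an even mode. -/
def evenRaise (t : Fin 13) (e : ℤ) : Module.End Cq Fock := shift (Pi.single t e, 0) fun _ => 1

/-- The diagonal operator with eigenvalue `1` or `x`, depending on an odd mode. -/
def oddScale (f : Fin 2) (x : Cq) : Module.End Cq Fock :=
  shift 0 fun m => if m.2 f = 0 then 1 else x

/-- The operator that raises an odd mode. -/
def oddRaise (f : Fin 2) : Module.End Cq Fock :=
  shift (0, Pi.single f 1) fun m => if m.2 f = 0 then 1 else 0

theorem isLocal_evenScale (t : Fin 13) (e : ℤ) : IsLocal (evenLevel t) (evenScale t e) :=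
  ⟨0, _, rfl, ⟨fun _ _ => rfl, fun _ _ => rfl⟩, fun m w hw => by simp [hw.1 t rfl]⟩

theorem isLocal_evenRaise (t : Fin 13) (e : ℤ) : IsLocal (evenLevel t) (evenRaise t e) := by
  refine ⟨_, _, rfl, ⟨fun s hs => ?_, fun _ _ => rfl⟩, fun _ _ _ => rfl⟩
  exact Pi.single_eq_of_ne (by rintro rfl; exact hs rfl) _

theorem isLocal_oddScale (f : Fin 2) (x : Cq) : IsLocal (10 + f) (oddScale f x) :=
  ⟨0, _, rfl, ⟨fun _ _ => rfl, fun _ _ => rfl⟩, fun m w hw => by simp [hw.2 f rfl]⟩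

theorem isLocal_oddRaise (f : Fin 2) : IsLocal (10 + f) (oddRaise f) := by
  refine ⟨_, _, rfl, ⟨fun _ _ => rfl, fun g hg => ?_⟩, fun m w hw => by simp [hw.2 f rfl]⟩
  exact Pi.single_eq_of_ne (by rintro rfl; exact hg rfl) _

theorem qpow_add (m n : ℤ) : qpow (m + n) = qpow m * qpow n := LaurentPolynomial.T_add m n

theorem qpow_zero : qpow 0 = 1 := LaurentPolynomial.T_zero

theorem evenScale_mul (t : Fin 13) (e e' : ℤ) :
    evenScale t e * evenScale t e' = evenScale t (e + e') := by
  simp [evenScale, shift_mul_shift, ← qpow_add, add_mul, add_comm]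

theorem evenScale_zero (t : Fin 13) : evenScale t 0 = 1 := by
  simp [evenScale, qpow_zero, shift_zero_one]

theorem isUnit_evenScale (t : Fin 13) (e : ℤ) : IsUnit (evenScale t e) :=
  ⟨⟨evenScale t e, evenScale t (-e), by simp [evenScale_mul, evenScale_zero],
    by simp [evenScale_mul, evenScale_zero]⟩, rfl⟩

theorem evenScale_mul_evenRaise (t : Fin 13) (e : ℤ) :
    evenScale t e * evenRaise t 1 = qpow e • (evenRaise t 1 * evenScale t e) := by
  simp [evenScale, evenRaise, shift_mul_shift, smul_shift, ← qpow_add, mul_add, add_comm]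

theorem evenRaise_mul_evenRaise (s t : Fin 13) (e e' : ℤ) :
    evenRaise s e * evenRaise t e' = shift (Pi.single s e + Pi.single t e', 0) fun _ => 1 := by
  simp [evenRaise, shift_mul_shift]

theorem isUnit_evenRaise (t : Fin 13) : IsUnit (evenRaise t 1) :=
  ⟨⟨evenRaise t 1, evenRaise t (-1),
    by simp [evenRaise_mul_evenRaise, ← Pi.single_add, Prod.mk_zero_zero, shift_zero_one],
    by simp [evenRaise_mul_evenRaise, ← Pi.single_add, Prod.mk_zero_zero, shift_zero_one]⟩, rfl⟩

theorem oddScale_mul (f : Fin 2) (x y : Cq) : oddScale f x * oddScale f y = oddScale f (x * y) := by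
  simp only [oddScale, shift_mul_shift, add_zero]
  congr 1
  funext m
  split_ifs <;> simp [mul_comm]

theorem oddScale_one (f : Fin 2) : oddScale f 1 = 1 := by
  simp [oddScale, shift_zero_one]

theorem isUnit_oddScale (f : Fin 2) {x y : Cq} (h : x * y = 1) : IsUnit (oddScale f x) :=
  ⟨⟨oddScale f x, oddScale f y, by rw [oddScale_mul, h, oddScale_one],
    by rw [oddScale_mul, mul_comm, h, oddScale_one]⟩, rfl⟩

theorem oddScale_mul_oddRaise (f : Fin 2) (x : Cq) :
    oddScale f x * oddRaise f = x • (oddRaise f * oddScale f x) := by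
  simp only [oddScale, oddRaise, shift_mul_shift, smul_shift, add_zero, zero_add]
  congr 1
  funext m
  by_cases h : m.2 f = 0 <;> simp [h]

theorem oddRaise_sq (f : Fin 2) : oddRaise f * oddRaise f = 0 := by
  apply fock_end_ext
  intro m
  by_cases h : m.2 f = 0 <;> simp [oddRaise, shift_single, h]

end Shift

end
end QuantumPoincare

namespace QuantumPoincare

noncomputable section

/-! ### The model of the parabolic -/

section Model

/-- The elementary factor of an even mode. -/
def evenFactor (t : Fin 13) (s : Fin 4) : Matrix (Fin 5) (Fin 5) (Module.End Cq Fock) :=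
  elementary s (evenScale t (-1)) (evenRaise t 1) (evenScale t 1)

/-- The elementary factor of an odd mode. -/
def oddFactor (f : Fin 2) : Matrix (Fin 5) (Fin 5) (Module.End Cq Fock) :=
  elementary 3 (oddScale f (qpow (-1))) (oddRaise f) (oddScale f (-qpow (-1)))

/-- The diagonal factor. -/
def torusFactor : Matrix (Fin 5) (Fin 5) (Module.End Cq Fock) :=
  Matrix.diagonal ![evenRaise 9 1, evenRaise 10 1, evenRaise 11 1, evenRaise 12 1, 1]

theorem evenFactor_rel (t : Fin 13) :
    evenRaise t 1 * evenScale t (-1) = qpow 1 • (evenScale t (-1) * evenRaise t 1) ∧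
    evenScale t 1 * evenRaise t 1 = qpow 1 • (evenRaise t 1 * evenScale t 1) ∧
    evenScale t 1 * evenScale t (-1) = evenScale t (-1) * evenScale t 1 := by
  refine ⟨?_, evenScale_mul_evenRaise t 1, by rw [evenScale_mul, evenScale_mul, add_comm]⟩
  rw [evenScale_mul_evenRaise, smul_smul, qpow_mul_qpow_neg, one_smul]

theorem blockLower_evenFactor (t : Fin 13) {s : Fin 4} (hs : s ≠ 3) :
    BlockLower (evenFactor t s) := by
  obtain ⟨h1, h2, h3⟩ := evenFactor_rel t
  refine blockLower_elementary s h1 ?_ h3 (fun h => absurd h hs) (isUnit_evenScale _ _)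
    (isUnit_evenScale _ _)
  rw [if_neg hs, h2]

theorem blockLower_evenFactor_transpose (t : Fin 13) {s : Fin 4} (hs : s = 0 ∨ s = 2) :
    BlockLower (evenFactor t s).transpose := by
  obtain ⟨h1, h2, h3⟩ := evenFactor_rel t
  exact blockLower_elementary_transpose hs h1 h2 h3 (isUnit_evenScale _ _) (isUnit_evenScale _ _)

theorem blockLower_oddFactor (f : Fin 2) : BlockLower (oddFactor f) := by
  refine blockLower_elementary 3 ?_ ?_ ?_ (fun _ => oddRaise_sq f)
    (isUnit_oddScale f qpow_neg_mul_qpow)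
    (isUnit_oddScale (y := -qpow 1) f (by rw [neg_mul_neg, qpow_neg_mul_qpow]))
  · rw [oddScale_mul_oddRaise, smul_smul, qpow_mul_qpow_neg, one_smul]
  · rw [if_pos rfl, oddScale_mul_oddRaise]
  · rw [oddScale_mul, oddScale_mul, mul_comm]

theorem commute_evenRaise (s t : Fin 13) : Commute (evenRaise s 1) (evenRaise t 1) := by
  rw [commute_iff_eq, evenRaise_mul_evenRaise, evenRaise_mul_evenRaise, add_comm]

theorem blockLower_torusFactor : BlockLower torusFactor := by
  refine blockLower_diagonal (fun i j => ?_) fun i => ?_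
  · fin_cases i <;> fin_cases j <;> simp [commute_evenRaise]
  · fin_cases i <;> simp [isUnit_evenRaise]

theorem isLocal_evenFactor (t : Fin 13) (s : Fin 4) (i j : Fin 5) :
    IsLocal (evenLevel t) (evenFactor t s i j) :=
  isLocal_elementary s (isLocal_evenScale _ _) (isLocal_evenRaise _ _) (isLocal_evenScale _ _) i j

theorem isLocal_oddFactor (f : Fin 2) (i j : Fin 5) : IsLocal (10 + f) (oddFactor f i j) :=
  isLocal_elementary 3 (isLocal_oddScale _ _) (isLocal_oddRaise _) (isLocal_oddScale _ _) i j

theorem isLocal_torusFactor (i j : Fin 5) : IsLocal 9 (torusFactor i j) := by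
  rw [torusFactor, Matrix.diagonal_apply]
  split_ifs with h
  · fin_cases i
    exacts [isLocal_evenRaise 9 1, isLocal_evenRaise 10 1, isLocal_evenRaise 11 1,
      isLocal_evenRaise 12 1, isLocal_one 9]
  · exact isLocal_zero 9

/-! ### The grading by the sign operator -/

/-- The sign operator of the odd modes. -/
def signOp : Module.End Cq Fock := oddScale 0 (-1) * oddScale 1 (-1)

section Graded

variable {R : Type*} [Ring R] {σ : R}

/-- Matrices whose entries commute with `σ` up to the sign given by the parity. -/
def IsGraded (σ : R) (A : Matrix (Fin 5) (Fin 5) R) : Prop :=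
  ∀ i j, A i j * σ = if (i = 4 ↔ j = 4) then σ * A i j else -(σ * A i j)

theorem IsGraded.mul {A B : Matrix (Fin 5) (Fin 5) R} (hA : IsGraded σ A)
    (hB : IsGraded σ B) : IsGraded σ (A * B) := by
  intro i j
  have : ∀ k, A i k * B k j * σ =
      if (i = 4 ↔ j = 4) then σ * (A i k * B k j) else -(σ * (A i k * B k j)) := by
    intro k
    have h : A i k * B k j * σ = A i k * (B k j * σ) := mul_assoc _ _ _
    have hA' := hA i k
    rw [h, hB k j]
    by_cases hi : i = 4 <;> by_cases hj : j = 4 <;> by_cases hk : k = 4 <;>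
      simp [hi, hj, hk, ← mul_assoc] at hA' ⊢ <;> simp [hA']
  simp only [Matrix.mul_apply, Finset.sum_mul, this, Finset.mul_sum]
  split_ifs
  · rfl
  · rw [Finset.sum_neg_distrib]

theorem isGraded_of_commute {A : Matrix (Fin 5) (Fin 5) R}
    (h : ∀ i j, Commute (A i j) σ) (h4 : ∀ i, i ≠ 4 → A i 4 = 0 ∧ A 4 i = 0) :
    IsGraded σ A := by
  intro i j
  by_cases hi : i = 4 <;> by_cases hj : j = 4
  · simp [hi, hj, (h 4 4).eq]
  · simp [hi, (h4 j hj).2]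
  · simp [hj, (h4 i hi).1]
  · simp [hi, hj, (h i j).eq]

theorem isGraded_elementary {α ξ δ : R} (hα : Commute α σ) (hδ : Commute δ σ)
    (hξ : ξ * σ = -(σ * ξ)) : IsGraded σ (elementary 3 α ξ δ) := by
  intro i j
  rw [elementary]
  by_cases hij : i = j
  · subst hij
    simp only [if_true]
    split_ifs <;> simp [hα.eq, hδ.eq]
  · by_cases h : i = Fin.succ 3 ∧ j = Fin.castSucc 3
    · obtain ⟨rfl, rfl⟩ := h
      simp [hξ]
    · rw [if_neg hij, if_neg h]
      simp

theorem isGraded_one : IsGraded σ (1 : Matrix (Fin 5) (Fin 5) R) :=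
  isGraded_of_commute
    (fun i j => by rw [Matrix.one_apply]; split_ifs; exacts [Commute.one_left σ, Commute.zero_left σ])
    fun _ hi => ⟨Matrix.one_apply_ne hi, Matrix.one_apply_ne hi.symm⟩

theorem anticommute_mul_right {a b x : R} (ha : a * x = -(x * a)) (hb : Commute x b) :
    x * (a * b) = -(a * b * x) := by
  rw [mul_assoc, ← hb.eq, ← mul_assoc, ← mul_assoc, ha, neg_mul, neg_neg]

theorem anticommute_mul_left {a b x : R} (ha : Commute x a) (hb : b * x = -(x * b)) :
    x * (a * b) = -(a * b * x) := by
  rw [mul_assoc, hb, mul_neg, neg_neg, ← mul_assoc, ← mul_assoc, ha.eq]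

end Graded

theorem signOp_sq : signOp * signOp = 1 := by
  have h : Commute (oddScale 0 (-1)) (oddScale 1 (-1)) :=
    (isLocal_oddScale 0 (-1)).commute (by decide) (isLocal_oddScale 1 (-1))
  have h1 : (-1 : Cq) * -1 = 1 := by ring
  rw [signOp, mul_assoc, ← mul_assoc (oddScale 1 (-1)), ← h.eq, mul_assoc, oddScale_mul,
    ← mul_assoc, oddScale_mul, h1, oddScale_one, oddScale_one, one_mul]

theorem commute_signOp {n : ℕ} (h0 : n ≠ 10) (h1 : n ≠ 11) {P : Module.End Cq Fock}
    (hP : IsLocal n P) : Commute P signOp :=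
  (hP.commute h0 (isLocal_oddScale 0 (-1))).mul_right (hP.commute h1 (isLocal_oddScale 1 (-1)))

theorem evenLevel_lt (t : Fin 13) : evenLevel t < 10 := by
  rw [evenLevel]
  omega

theorem evenFactor_last (t : Fin 13) {s : Fin 4} (hs : s ≠ 3) {i : Fin 5} (hi : i ≠ 4) :
    evenFactor t s i 4 = 0 ∧ evenFactor t s 4 i = 0 := by
  have h : s.succ ≠ 4 := by
    rw [Ne, Fin.ext_iff] at *
    simp at *
    omega
  constructor
  · rw [evenFactor, elementary, if_neg hi, if_neg]
    rintro ⟨-, h'⟩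
    simp only [Fin.ext_iff, Fin.val_castSucc] at h'
    omega
  · rw [evenFactor, elementary, if_neg hi.symm, if_neg]
    rintro ⟨h', -⟩
    exact h h'.symm

theorem isGraded_evenFactor (t : Fin 13) {s : Fin 4} (hs : s ≠ 3) :
    IsGraded signOp (evenFactor t s) :=
  isGraded_of_commute (fun i j => commute_signOp (evenLevel_lt t).ne (by have := evenLevel_lt t; omega)
    (isLocal_evenFactor t s i j)) fun _ hi => evenFactor_last t hs hi

theorem isGraded_evenFactor_transpose (t : Fin 13) {s : Fin 4} (hs : s ≠ 3) :
    IsGraded signOp (evenFactor t s).transpose :=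
  isGraded_of_commute (fun i j => commute_signOp (evenLevel_lt t).ne (by have := evenLevel_lt t; omega)
    (isLocal_evenFactor t s j i)) fun _ hi => (evenFactor_last t hs hi).symm

theorem isGraded_torusFactor : IsGraded signOp torusFactor :=
  isGraded_of_commute (fun i j => commute_signOp (by decide) (by decide) (isLocal_torusFactor i j))
    fun _ hi => ⟨Matrix.diagonal_apply_ne _ hi, Matrix.diagonal_apply_ne _ hi.symm⟩

theorem commute_oddScale_signOp (f : Fin 2) (x : Cq) : Commute (oddScale f x) signOp := by
  have h : ∀ g, Commute (oddScale f x) (oddScale g (-1)) := by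
    intro g
    by_cases hfg : f = g
    · subst hfg
      rw [commute_iff_eq, oddScale_mul, oddScale_mul, mul_comm]
    · exact (isLocal_oddScale f x).commute (by simpa [Fin.ext_iff] using hfg)
        (isLocal_oddScale g (-1))
  exact (h 0).mul_right (h 1)

theorem oddRaise_mul_signOp (f : Fin 2) : oddRaise f * signOp = -(signOp * oddRaise f) := by
  have h : ∀ f, oddScale f (-1) * oddRaise f = -(oddRaise f * oddScale f (-1)) := by
    intro f
    apply fock_end_ext
    intro m
    by_cases h : m.2 f = 0 <;> simp [oddScale, oddRaise, shift_single, h]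
  fin_cases f
  · exact anticommute_mul_right (R := Module.End Cq Fock) (h 0)
      ((isLocal_oddRaise 0).commute (by decide) (isLocal_oddScale 1 (-1)))
  · exact anticommute_mul_left (R := Module.End Cq Fock)
      ((isLocal_oddRaise 1).commute (by decide) (isLocal_oddScale 0 (-1))) (h 1)

theorem isGraded_oddFactor (f : Fin 2) : IsGraded signOp (oddFactor f) :=
  isGraded_elementary (commute_oddScale_signOp f _) (commute_oddScale_signOp f _)
    (oddRaise_mul_signOp f)

/-- The factors of the model, with their levels. -/
def factors : List (ℕ × Matrix (Fin 5) (Fin 5) (Module.End Cq Fock)) :=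
  -- The even modes `1` to `12` are as many as the entries of `t`, `x` and `y`. Mode `0` mixes row 3
  -- into row 4 between the two odd factors; without it, both odd contributions to row 5 would be
  -- multiples of the same row.
  [(10, oddFactor 0), (0, evenFactor 0 2), (11, oddFactor 1), (1, evenFactor 1 1),
    (2, evenFactor 2 0), (3, evenFactor 3 2), (4, evenFactor 4 1), (5, evenFactor 5 0),
    (6, evenFactor 6 2), (9, torusFactor), (7, (evenFactor 7 0).transpose),
    (8, (evenFactor 8 2).transpose)]

theorem commute_prod_of_levels (n : ℕ) {P : Module.End Cq Fock} (hP : IsLocal n P)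
    (L : List (ℕ × Matrix (Fin 5) (Fin 5) (Module.End Cq Fock)))
    (hL : ∀ x ∈ L, n ≠ x.1 ∧ ∀ i j, IsLocal x.1 (x.2 i j)) (i j : Fin 5) :
    Commute P ((L.map Prod.snd).prod i j) := by
  induction L generalizing i j with
  | nil =>
    rw [List.map_nil, List.prod_nil, Matrix.one_apply]
    split_ifs
    exacts [Commute.one_right P, Commute.zero_right P]
  | cons x L ih =>
    rw [List.map_cons, List.prod_cons, Matrix.mul_apply]
    refine Commute.sum_right _ _ _ fun k _ => Commute.mul_right ?_ ?_
    · obtain ⟨h1, h2⟩ := hL x List.mem_cons_self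
      exact hP.commute h1 (h2 i k)
    · exact ih (fun y hy => hL y (List.mem_cons_of_mem x hy)) k j

/-- Distinct levels provide the commutation of entries that products of solutions of the exchange
relation require. -/
theorem blockLower_prod (L : List (ℕ × Matrix (Fin 5) (Fin 5) (Module.End Cq Fock)))
    (hL : (L.map Prod.fst).Nodup) (hloc : ∀ x ∈ L, ∀ i j, IsLocal x.1 (x.2 i j))
    (hB : ∀ x ∈ L, BlockLower x.2) : BlockLower (L.map Prod.snd).prod := by
  induction L with
  | nil =>
    rw [List.map_nil, List.prod_nil, ← Matrix.diagonal_one]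
    exact blockLower_diagonal (fun _ _ => Commute.refl _) fun _ => isUnit_one
  | cons x L ih =>
    rw [List.map_cons, List.nodup_cons] at hL
    rw [List.map_cons, List.prod_cons]
    refine (hB x List.mem_cons_self).mul
      (ih hL.2 (fun y hy => hloc y (List.mem_cons_of_mem x hy))
        fun y hy => hB y (List.mem_cons_of_mem x hy)) fun i j k l => ?_
    refine (commute_prod_of_levels x.1 (hloc x List.mem_cons_self k l) L (fun y hy => ⟨?_, ?_⟩)
      i j).symm
    · intro h
      exact hL.1 (h ▸ List.mem_map_of_mem hy)
    · exact hloc y (List.mem_cons_of_mem x hy)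

theorem isGraded_prod (L : List (ℕ × Matrix (Fin 5) (Fin 5) (Module.End Cq Fock)))
    (hL : ∀ x ∈ L, IsGraded signOp x.2) : IsGraded signOp (L.map Prod.snd).prod := by
  induction L with
  | nil => exact isGraded_one
  | cons x L ih =>
    rw [List.map_cons, List.prod_cons]
    exact (hL x List.mem_cons_self).mul (ih fun y hy => hL y (List.mem_cons_of_mem x hy))

/-- The matrix of the model. -/
def modelMatrix : Matrix (Fin 5) (Fin 5) (Module.End Cq Fock) := (factors.map Prod.snd).prod

theorem parModel : ParModel modelMatrix signOp := by
  have hG : IsGraded signOp modelMatrix := by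
    apply isGraded_prod
    simp only [factors, List.forall_mem_cons, List.not_mem_nil, false_imp_iff, implies_true,
      and_true]
    refine ⟨isGraded_oddFactor _, isGraded_evenFactor _ (by decide), isGraded_oddFactor _,
      isGraded_evenFactor _ (by decide), isGraded_evenFactor _ (by decide),
      isGraded_evenFactor _ (by decide), isGraded_evenFactor _ (by decide),
      isGraded_evenFactor _ (by decide), isGraded_evenFactor _ (by decide),
      isGraded_torusFactor, isGraded_evenFactor_transpose _ (by decide),
      isGraded_evenFactor_transpose _ (by decide)⟩
  have hB : BlockLower modelMatrix := by
    apply blockLower_prod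
    · simp only [factors, List.map_cons, List.map_nil]
      decide
    · simp only [factors, List.forall_mem_cons, List.not_mem_nil, false_imp_iff, implies_true,
        and_true]
      exact ⟨isLocal_oddFactor 0, isLocal_evenFactor 0 _, isLocal_oddFactor 1,
        isLocal_evenFactor 1 _, isLocal_evenFactor 2 _, isLocal_evenFactor 3 _,
        isLocal_evenFactor 4 _, isLocal_evenFactor 5 _, isLocal_evenFactor 6 _,
        isLocal_torusFactor, fun i j => isLocal_evenFactor 7 _ j i,
        fun i j => isLocal_evenFactor 8 _ j i⟩
    · simp only [factors, List.forall_mem_cons, List.not_mem_nil, false_imp_iff, implies_true,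
        and_true]
      exact ⟨blockLower_oddFactor _, blockLower_evenFactor _ (by decide), blockLower_oddFactor _,
        blockLower_evenFactor _ (by decide), blockLower_evenFactor _ (by decide),
        blockLower_evenFactor _ (by decide), blockLower_evenFactor _ (by decide),
        blockLower_evenFactor _ (by decide), blockLower_evenFactor _ (by decide),
        blockLower_torusFactor, blockLower_evenFactor_transpose _ (by decide),
        blockLower_evenFactor_transpose _ (by decide)⟩
  refine ⟨hB, signOp_sq, fun i j hi => ?_, fun j hj => (hG 4 j).trans (if_neg (by simp [hj])),
    fock_end_torsion⟩
  by_cases hj : j = 4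
  · rw [hj, hB.zero_last i (by omega)]
    exact Commute.zero_right _
  · exact ((hG i j).trans (if_pos (by simp [hi, hj]))).symm

end Model

end
end QuantumPoincare

namespace QuantumPoincare

noncomputable section

/-! ### The classical limit of the model -/

section Limit

set_option linter.unusedSectionVars false
set_option linter.unusedSimpArgs false

/-- Specialization at `q = 1`. -/
def atOne : Cq →+* ℂ := LaurentPolynomial.eval₂ (RingHom.id ℂ) 1

theorem atOne_qpow (n : ℤ) : atOne (qpow n) = 1 := by
  simp [atOne, qpow]

variable {K : Type*} [Field K] [Algebra ℂ K]

/-- The limit at `q = 1`, in which the even modes take the values `u` and the odd modes remain. -/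
def limit (u : Fin 13 → K) : Fock →+ ((Fin 2 → ZMod 2) → K) :=
  Finsupp.liftAddHom fun m =>
    { toFun := fun x => Pi.single m.2 (algebraMap ℂ K (atOne x) * ∏ t, u t ^ m.1 t)
      map_zero' := by simp
      map_add' := fun x y => by simp [add_mul, Pi.single_add] }

theorem limit_single (u : Fin 13 → K) (m : Mode) (x : Cq) : limit u (Finsupp.single m x) =
    Pi.single m.2 (algebraMap ℂ K (atOne x) * ∏ t, u t ^ m.1 t) := by
  simp [limit]

/-- The operator `Q` describes `P` in the limit. -/
def HasLimit (u : Fin 13 → K) (P : Module.End Cq Fock)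
    (Q : Module.End K ((Fin 2 → ZMod 2) → K)) : Prop :=
  ∀ f, limit u (P f) = Q (limit u f)

variable {u : Fin 13 → K} {P P' : Module.End Cq Fock}
  {Q Q' : Module.End K ((Fin 2 → ZMod 2) → K)}

theorem hasLimit_of_single (h : ∀ m x, limit u (P (Finsupp.single m x)) =
    Q (Pi.single m.2 (algebraMap ℂ K (atOne x) * ∏ t, u t ^ m.1 t))) : HasLimit u P Q := by
  intro f
  induction f using Finsupp.induction_linear with
  | zero => simp
  | add f g hf hg => rw [map_add, map_add, map_add, map_add, hf, hg]
  | single m x => rw [h, limit_single]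

/-- The limit is semilinear along `q = 1`; in particular powers of `q` become invisible. -/
theorem limit_smul (c : Cq) (f : Fock) : limit u (c • f) = algebraMap ℂ K
    (atOne c) • limit u f := by
  induction f using Finsupp.induction_linear with
  | zero => simp
  | add f g hf hg => rw [smul_add, map_add, map_add, hf, hg, smul_add]
  | single m x =>
    rw [Finsupp.smul_single, limit_single, limit_single, ← Pi.single_smul, smul_eq_mul, smul_eq_mul,
      map_mul, map_mul, mul_assoc]

theorem HasLimit.mul (h : HasLimit u P Q) (h' : HasLimit u P' Q') :
    HasLimit u (P * P') (Q * Q') := fun f => by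
  rw [Module.End.mul_apply, Module.End.mul_apply, h, h']

theorem HasLimit.add (h : HasLimit u P Q) (h' : HasLimit u P' Q') :
    HasLimit u (P + P') (Q + Q') := fun f => by
  rw [LinearMap.add_apply, LinearMap.add_apply, map_add, h, h']

theorem HasLimit.sub (h : HasLimit u P Q) (h' : HasLimit u P' Q') :
    HasLimit u (P - P') (Q - Q') := fun f => by
  rw [LinearMap.sub_apply, LinearMap.sub_apply, map_sub, h, h']

theorem HasLimit.neg (h : HasLimit u P Q) : HasLimit u (-P) (-Q) := fun f => by
  rw [LinearMap.neg_apply, LinearMap.neg_apply, map_neg, h]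

theorem hasLimit_zero : HasLimit u 0 0 := fun f => by
  rw [LinearMap.zero_apply, LinearMap.zero_apply, map_zero]

theorem hasLimit_one : HasLimit u 1 1 := fun _ => rfl

theorem HasLimit.qpow_smul (h : HasLimit u P Q) (n : ℤ) : HasLimit u (qpow n • P) Q := fun f => by
  rw [LinearMap.smul_apply, limit_smul, atOne_qpow, map_one, one_smul, h]

theorem HasLimit.pow (h : HasLimit u P Q) (n : ℕ) : HasLimit u (P ^ n) (Q ^ n) := by
  induction n with
  | zero => simpa using hasLimit_one
  | succ n ih =>
    rw [pow_succ, pow_succ]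
    exact ih.mul h

theorem hasLimit_list_prod {n : ℕ} {p : Fin n → Module.End Cq Fock}
    {r : Fin n → Module.End K ((Fin 2 → ZMod 2) → K)} (h : ∀ i, HasLimit u (p i) (r i)) :
    HasLimit u (List.ofFn p).prod (List.ofFn r).prod := by
  induction n with
  | zero => simpa using hasLimit_one
  | succ n ih =>
    rw [List.ofFn_succ, List.ofFn_succ, List.prod_cons, List.prod_cons]
    exact (h 0).mul (ih fun i => h i.succ)

theorem hasLimit_sum {ι : Type*} (s : Finset ι) {p : ι → Module.End Cq Fock}
    {r : ι → Module.End K ((Fin 2 → ZMod 2) → K)} (h : ∀ i, HasLimit u (p i) (r i)) :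
    HasLimit u (∑ i ∈ s, p i) (∑ i ∈ s, r i) := by
  classical
  induction s using Finset.induction_on with
  | empty => simpa using hasLimit_zero
  | insert a s ha ih =>
    rw [Finset.sum_insert ha, Finset.sum_insert ha]
    exact (h a).add ih

/-- Multiplication by a scalar, as an operator. -/
def scalar : K →ₐ[K] Module.End K ((Fin 2 → ZMod 2) → K) := Algebra.ofId _ _

theorem scalar_apply (c : K) (φ : (Fin 2 → ZMod 2) → K) : scalar c φ = c • φ := rfl

theorem hasLimit_evenScale (t : Fin 13) (e : ℤ) : HasLimit u (evenScale t e) 1 := by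
  apply hasLimit_of_single
  intro m x
  simp only [evenScale, shift_single, limit_single, map_mul, atOne_qpow, map_one, mul_one, add_zero,
    Module.End.one_apply]

/-- Exponents of even modes are integers, so the values `u` have to be nonzero for a shift to become
a multiplication. -/
theorem hasLimit_evenRaise (hu : ∀ t, u t ≠ 0) (t : Fin 13) :
    HasLimit u (evenRaise t 1) (scalar (u t)) := by
  apply hasLimit_of_single
  intro m x
  have : ∏ s, u s ^ (m.1 + (Pi.single t 1 : Fin 13 → ℤ)) s = u t * ∏ s, u s ^ m.1 s := by
    simp only [Pi.add_apply, zpow_add₀ (hu _), Finset.prod_mul_distrib]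
    rw [mul_comm]
    congr 1
    rw [Finset.prod_eq_single t]
    · simp
    · intro s _ hs
      simp [Pi.single_eq_of_ne hs]
    · simp
  simp only [evenRaise, shift_single, limit_single, Prod.fst_add, Prod.snd_add, this, add_zero,
    mul_one, scalar_apply]
  rw [← Pi.single_smul, smul_eq_mul, mul_left_comm]

/-- The sign of an odd mode. -/
def oddSign (f : Fin 2) : Module.End K ((Fin 2 → ZMod 2) → K) where
  toFun φ S := if S f = 0 then φ S else -φ S
  map_add' φ ψ := by
    funext S
    simp only [Pi.add_apply]
    split_ifs <;> ring
  map_smul' c φ := by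
    funext S
    simp

/-- Multiplication by an odd variable. -/
def oddVar (f : Fin 2) : Module.End K ((Fin 2 → ZMod 2) → K) where
  toFun φ S := if S f = 1 then φ (S - Pi.single f 1) else 0
  map_add' φ ψ := by
    funext S
    simp only [Pi.add_apply]
    split_ifs <;> simp
  map_smul' c φ := by
    funext S
    simp

theorem hasLimit_oddScale (f : Fin 2) : HasLimit u (oddScale f (qpow (-1))) 1 := by
  apply hasLimit_of_single
  intro m x
  by_cases h : m.2 f = 0 <;>
    simp only [oddScale, shift_single, limit_single, map_mul, atOne_qpow, map_one, mul_one, add_zero,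
      Module.End.one_apply, h, if_true, if_false]

/-- The minus sign survives at `q = 1`; in the limit it makes the odd variables anticommute. -/
theorem hasLimit_oddScale_neg (f : Fin 2) : HasLimit u (oddScale f (-qpow (-1))) (oddSign f) := by
  apply hasLimit_of_single
  intro m x
  funext S
  by_cases hS : S = m.2
  · subst hS
    by_cases h : m.2 f = 0 <;>
      simp [-Finsupp.single_mul, oddScale, shift_single, limit_single, atOne_qpow, h, oddSign]
  · by_cases h : m.2 f = 0 <;>
      simp [-Finsupp.single_mul, oddScale, shift_single, limit_single, atOne_qpow, h, oddSign, hS]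

theorem hasLimit_oddRaise (f : Fin 2) : HasLimit u (oddRaise f) (oddVar f) := by
  apply hasLimit_of_single
  intro m x
  have h2 : ∀ a : ZMod 2, a = 0 ∨ a = 1 := by decide
  funext S
  by_cases hS : S = m.2 + Pi.single f 1
  · subst hS
    rcases h2 (m.2 f) with h | h <;>
      simp [oddRaise, shift_single, limit_single, h, oddVar]
  · have hS' : S - Pi.single f 1 ≠ m.2 := fun h => hS (by rw [← h, sub_add_cancel])
    rcases h2 (m.2 f) with h | h <;>
      simp [oddRaise, shift_single, limit_single, h, oddVar, hS, hS']

/-- Entrywise limits of matrices. -/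
def MatrixHasLimit (u : Fin 13 → K) (A : Matrix (Fin 5) (Fin 5) (Module.End Cq Fock))
    (B : Matrix (Fin 5) (Fin 5) (Module.End K ((Fin 2 → ZMod 2) → K))) : Prop :=
  ∀ i j, HasLimit u (A i j) (B i j)

theorem MatrixHasLimit.mul {A A' : Matrix (Fin 5) (Fin 5) (Module.End Cq Fock)}
    {B B' : Matrix (Fin 5) (Fin 5) (Module.End K ((Fin 2 → ZMod 2) → K))}
    (h : MatrixHasLimit u A B) (h' : MatrixHasLimit u A' B') :
    MatrixHasLimit u (A * A') (B * B') := by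
  intro i j
  rw [Matrix.mul_apply, Matrix.mul_apply]
  exact hasLimit_sum _ fun k => (h i k).mul (h' k j)

theorem MatrixHasLimit.scalar_mul {A A' : Matrix (Fin 5) (Fin 5) (Module.End Cq Fock)}
    {B B' : Matrix (Fin 5) (Fin 5) K}
    (h : MatrixHasLimit u A (B.map scalar)) (h' : MatrixHasLimit u A' (B'.map scalar)) :
    MatrixHasLimit u (A * A') ((B * B').map scalar) := by
  rw [Matrix.map_mul]
  exact h.mul h'

theorem matrixHasLimit_elementary (s : Fin 4) {α ξ δ : Module.End Cq Fock}
    {α' ξ' δ' : Module.End K ((Fin 2 → ZMod 2) → K)} (hα : HasLimit u α α') (hξ : HasLimit u ξ ξ')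
    (hδ : HasLimit u δ δ') :
    MatrixHasLimit u (elementary s α ξ δ) (elementary s α' ξ' δ') := by
  intro i j
  rw [elementary, elementary]
  split_ifs
  exacts [hα, hδ, hasLimit_one, hξ, hasLimit_zero]

theorem elementary_map_scalar (s : Fin 4) (c : K) : (elementary s 1 c 1).map scalar =
    elementary s 1 (scalar c) (1 : Module.End K ((Fin 2 → ZMod 2) → K)) := by
  ext1 i j
  rw [Matrix.map_apply, elementary, elementary]
  split_ifs <;> simp

theorem matrixHasLimit_evenFactor (hu : ∀ t, u t ≠ 0) (t : Fin 13) (s : Fin 4) :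
    MatrixHasLimit u (evenFactor t s) ((elementary s 1 (u t) 1).map scalar) := by
  rw [elementary_map_scalar]
  exact matrixHasLimit_elementary s (hasLimit_evenScale _ _) (hasLimit_evenRaise hu t)
    (hasLimit_evenScale _ _)

theorem matrixHasLimit_torusFactor (hu : ∀ t, u t ≠ 0) :
    MatrixHasLimit u torusFactor
      ((Matrix.diagonal ![u 9, u 10, u 11, u 12, 1]).map scalar) := by
  intro i j
  rw [torusFactor, Matrix.map_apply, Matrix.diagonal_apply, Matrix.diagonal_apply]
  split_ifs
  · fin_cases i
    exacts [hasLimit_evenRaise hu 9, hasLimit_evenRaise hu 10, hasLimit_evenRaise hu 11,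
      hasLimit_evenRaise hu 12, by simpa using hasLimit_one]
  · rw [map_zero]
    exact hasLimit_zero

/-- The classical limit of the product of the even factors after the first one. -/
def evenLimit (u : Fin 13 → K) : Matrix (Fin 5) (Fin 5) K :=
  elementary 1 1 (u 1) 1 * (elementary 0 1 (u 2) 1 * (elementary 2 1 (u 3) 1 *
    (elementary 1 1 (u 4) 1 * (elementary 0 1 (u 5) 1 * (elementary 2 1 (u 6) 1 *
      (Matrix.diagonal ![u 9, u 10, u 11, u 12, 1] *
        ((elementary 0 1 (u 7) 1).transpose * (elementary 2 1 (u 8) 1).transpose)))))))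

theorem matrixHasLimit_modelMatrix (hu : ∀ t, u t ≠ 0) :
    MatrixHasLimit u modelMatrix (elementary 3 1 (oddVar 0) (oddSign 0) *
      ((elementary 2 1 (u 0) 1).map scalar * (elementary 3 1 (oddVar 1) (oddSign 1) *
        (evenLimit u).map scalar))) := by
  have hodd : ∀ f, MatrixHasLimit u (oddFactor f) (elementary 3 1 (oddVar f) (oddSign f)) :=
    fun f => matrixHasLimit_elementary 3 (hasLimit_oddScale f) (hasLimit_oddRaise f)
      (hasLimit_oddScale_neg f)
  have heven := matrixHasLimit_evenFactor hu
  have hT : ∀ t s, MatrixHasLimit u (evenFactor t s).transpose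
      ((elementary s 1 (u t) 1).transpose.map scalar) := fun t s i j => heven t s j i
  have h : modelMatrix = oddFactor 0 * (evenFactor 0 2 * (oddFactor 1 * (evenFactor 1 1 *
      (evenFactor 2 0 * (evenFactor 3 2 * (evenFactor 4 1 * (evenFactor 5 0 * (evenFactor 6 2 *
      (torusFactor * ((evenFactor 7 0).transpose * (evenFactor 8 2).transpose)))))))))) := by
    simp only [modelMatrix, factors, List.map_cons, List.map_nil, List.prod_cons, List.prod_nil,
      mul_one]
  rw [h]
  exact (hodd 0).mul ((heven 0 2).mul ((hodd 1).mul ((heven 1 1).scalar_mul ((heven 2 0).scalar_mul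
    ((heven 3 2).scalar_mul ((heven 4 1).scalar_mul ((heven 5 0).scalar_mul ((heven 6 2).scalar_mul
    ((matrixHasLimit_torusFactor hu).scalar_mul ((hT 7 0).scalar_mul (hT 8 2)))))))))))

theorem elementary_mul_apply {R : Type*} [Ring R] (s : Fin 4) (ξ δ : R)
    (M : Matrix (Fin 5) (Fin 5) R) (i j : Fin 5) :
    (elementary s 1 ξ δ * M) i j =
      if i = s.succ then ξ * M s.castSucc j + δ * M s.succ j else M i j := by
  fin_cases s <;> fin_cases i <;> simp [Matrix.mul_apply, elementary, Fin.sum_univ_five]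

end Limit

end
end QuantumPoincare

namespace QuantumPoincare

noncomputable section

/-! ### The classical limit of the generators -/

section Generators

set_option linter.unusedSectionVars false
set_option linter.unusedSimpArgs false

variable {K : Type*} [Field K] [Algebra ℂ K]

/-- The values of the modes for which the even generators of the quantum Poincaré group have the
limits `z`. -/
def modeValue (z : Fin 12 → K) : Fin 13 → K :=
  ![1, z 0 - (z 2 - z 0) * z 1 / (z 3 - z 1), -((z 3 - z 1) / (z 2 - z 0)), (z 3 - z 1) / z 1,
    (z 2 - z 0) * z 1 / (z 3 - z 1), z 6 / z 4 + (z 3 - z 1) / (z 2 - z 0), z 10 / z 8 - z 3 / z 1,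
    z 5 / z 4, z 9 / z 8, z 4, z 7 - z 6 * z 5 / z 4, z 8, z 11 - z 10 * z 9 / z 8]

/-- The conditions under which the values of the modes are defined and do not vanish. -/
structure Generic (z : Fin 12 → K) : Prop where
  h1 : z 1 ≠ 0
  h4 : z 4 ≠ 0
  h5 : z 5 ≠ 0
  h8 : z 8 ≠ 0
  h9 : z 9 ≠ 0
  h31 : z 3 - z 1 ≠ 0
  h20 : z 2 - z 0 ≠ 0
  ht : z 0 * z 3 - z 2 * z 1 ≠ 0
  hx : z 4 * z 7 - z 5 * z 6 ≠ 0
  hy : z 8 * z 11 - z 9 * z 10 ≠ 0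
  hxt : z 6 * (z 2 - z 0) + z 4 * (z 3 - z 1) ≠ 0
  hyt : z 10 * z 1 - z 3 * z 8 ≠ 0

variable {z : Fin 12 → K}

theorem div_ne_zero_of_eq {a b c : K} (h : a = b / c) (hb : b ≠ 0) (hc : c ≠ 0) : a ≠ 0 :=
  h ▸ div_ne_zero hb hc

theorem Generic.modeValue_ne_zero (h : Generic z) (t : Fin 13) : modeValue z t ≠ 0 := by
  obtain ⟨h1, h4, h5, h8, h9, h31, h20, ht, hx, hy, hxt, hyt⟩ := h
  fin_cases t
  · exact one_ne_zero
  · exact div_ne_zero_of_eq (show z 0 - (z 2 - z 0) * z 1 / (z 3 - z 1) = _ / _ by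
      rw [eq_div_iff h31, sub_mul, div_mul_cancel₀ _ h31]; ring) ht h31
  · exact neg_ne_zero.2 (div_ne_zero h31 h20)
  · exact div_ne_zero h31 h1
  · exact div_ne_zero (mul_ne_zero h20 h1) h31
  · exact div_ne_zero_of_eq (div_add_div _ _ h4 h20) hxt (mul_ne_zero h4 h20)
  · refine div_ne_zero_of_eq (div_sub_div _ _ h8 h1) ?_ (mul_ne_zero h8 h1)
    rwa [mul_comm (z 8)]
  · exact div_ne_zero h5 h4
  · exact div_ne_zero h9 h8
  · exact h4
  · exact div_ne_zero_of_eq (show z 7 - z 6 * z 5 / z 4 = _ / _ by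
      rw [eq_div_iff h4, sub_mul, div_mul_cancel₀ _ h4]; ring) hx h4
  · exact h8
  · exact div_ne_zero_of_eq (show z 11 - z 10 * z 9 / z 8 = _ / _ by
      rw [eq_div_iff h8, sub_mul, div_mul_cancel₀ _ h8]; ring) hy h8

/-- The limits of the entries of the first four rows. -/
def entryValue (z : Fin 12 → K) : Matrix (Fin 4) (Fin 5) K :=
  !![z 4, z 5, 0, 0, 0;
    z 6, z 7, 0, 0, 0;
    z 1 * z 4 + z 0 * z 6, z 1 * z 5 + z 0 * z 7, z 8, z 9, 0;
    z 3 * z 4 + z 2 * z 6, z 3 * z 5 + z 2 * z 7, z 10, z 11, 0]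

theorem evenLimit_apply (u : Fin 13 → K) (i j : Fin 5) : evenLimit u i j =
    !![u 9, u 9 * u 7, 0, 0, 0;
      (u 2 + u 5) * u 9, (u 2 + u 5) * (u 9 * u 7) + u 10, 0, 0, 0;
      (u 1 * (u 2 + u 5) + u 4 * u 5) * u 9,
        (u 1 * (u 2 + u 5) + u 4 * u 5) * (u 9 * u 7) + (u 1 + u 4) * u 10, u 11, u 11 * u 8, 0;
      u 3 * u 4 * u 5 * u 9, u 3 * u 4 * (u 5 * (u 9 * u 7) + u 10), (u 3 + u 6) * u 11,
        (u 3 + u 6) * (u 11 * u 8) + u 12, 0;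
      0, 0, 0, 0, 1] i j := by
  rw [evenLimit, ← Matrix.transpose_mul]
  simp only [elementary_mul_apply, Matrix.diagonal_mul, Matrix.transpose_apply]
  fin_cases i <;> fin_cases j <;> simp [elementary] <;> ring

/-- Row 4 is `e₃ - e₂` here, since the first even factor, of value `1`, later adds row 3 to row 4.
Comparing the rows through `x` gives `-u₂u₄ = z₁`, `u₁ + u₄ = z₀`, `u₃u₄ = z₂ - z₀` and `-u₂u₃u₄ =
z₃ - z₁`; solving these, together with the triangular factorizations of `x` and `y`, produces the
formulas of `modeValue`. -/
theorem Generic.evenLimit_eq (h : Generic z) (j : Fin 5) :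
    evenLimit (modeValue z) 0 j = entryValue z 0 j ∧
    evenLimit (modeValue z) 1 j = entryValue z 1 j ∧
    evenLimit (modeValue z) 2 j = entryValue z 2 j ∧
    evenLimit (modeValue z) 3 j = entryValue z 3 j - entryValue z 2 j := by
  obtain ⟨h1, h4, h5, h8, h9, h31, h20, ht, hx, hy, hxt, hyt⟩ := h
  simp only [evenLimit_apply]
  fin_cases j <;> simp [modeValue, entryValue]
  all_goals (try constructor) <;> (try constructor) <;> (try constructor)
  all_goals field_simp
  all_goals ring

end Generators

end
end QuantumPoincare

/-! ### Limits of entries, minors and ordered monomials -/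

namespace QuantumPoincare

noncomputable section

section Limits

set_option linter.unusedSectionVars false
set_option linter.unusedSimpArgs false

variable {K : Type*} [Field K] [Algebra ℂ K] {z : Fin 12 → K}

/-- A combination of the two odd variables. -/
def oddPair (c d : K) : Module.End K ((Fin 2 → ZMod 2) → K) :=
  c • oddVar 0 + d • (oddSign 0 * oddVar 1)

theorem scalar_eq_smul (c : K) : scalar c = c • (1 : Module.End K ((Fin 2 → ZMod 2) → K)) := rfl

theorem scalar_mul_oddPair (x c d : K) : scalar x * oddPair c d = oddPair (x * c) (x * d) := by
  simp only [oddPair, scalar_eq_smul, smul_mul_assoc, one_mul, smul_add, smul_smul]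

theorem oddPair_mul_scalar (x c d : K) : oddPair c d * scalar x = oddPair (c * x) (d * x) := by
  rw [show oddPair c d * scalar x = scalar x * oddPair c d from
    (Algebra.commutes x (oddPair c d)).symm, scalar_mul_oddPair, mul_comm x, mul_comm x]

theorem oddPair_sub (c d c' d' : K) : oddPair c d - oddPair c' d' = oddPair (c - c') (d - d') := by
  simp only [oddPair]
  module

theorem oddPair_neg (c d : K) : -oddPair c d = oddPair (-c) (-d) := by
  simp only [oddPair]
  module

/-- The first three factors act as row operations: row 5 receives the first odd variable times row 4
after the mixing, and the second one times row 4 before it. -/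
theorem hasLimit_modelMatrix (h : Generic z) (i j : Fin 5) :
    HasLimit (modeValue z) (modelMatrix i j)
      (if i = 4 then oddVar 0 * scalar (evenLimit (modeValue z) 3 j + evenLimit (modeValue z) 2 j) +
        oddSign 0 * (oddVar 1 * scalar (evenLimit (modeValue z) 3 j) +
          oddSign 1 * scalar (evenLimit (modeValue z) 4 j))
      else if i = 3 then scalar (evenLimit (modeValue z) 3 j + evenLimit (modeValue z) 2 j)
      else scalar (evenLimit (modeValue z) i j)) := by
  have hm := matrixHasLimit_modelMatrix h.modeValue_ne_zero i j
  simp only [elementary_map_scalar, elementary_mul_apply, Matrix.map_apply, one_mul,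
    show modeValue z 0 = 1 from rfl, map_one] at hm
  convert hm using 1
  fin_cases i <;> simp [Fin.ext_iff, add_comm]

theorem hasLimit_entry (h : Generic z) {i : Fin 5} (i' : Fin 4) (hi : i = i'.castSucc) (j : Fin 5) :
    HasLimit (modeValue z) (parModel.lift (a i j)) (scalar (entryValue z i' j)) := by
  have hm := hasLimit_modelMatrix h i j
  subst hi
  rw [parModel.lift_a, twist_left (by fin_cases i' <;> decide)]
  obtain ⟨h0, h1, h2, h3⟩ := h.evenLimit_eq j
  convert hm using 1
  fin_cases i' <;> simp [Fin.ext_iff, h0, h1, h2, h3]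

theorem hasLimit_entry_odd (h : Generic z) {j : Fin 5} (hj : j ≠ 4) :
    HasLimit (modeValue z) (parModel.lift (a 4 j))
      (oddPair (entryValue z 3 j) (entryValue z 3 j - entryValue z 2 j)) := by
  have hm := hasLimit_modelMatrix h 4 j
  rw [parModel.lift_a, twist_right hj]
  obtain ⟨h0, h1, h2, h3⟩ := h.evenLimit_eq j
  have h4 : evenLimit (modeValue z) 4 j = 0 := by
    rw [evenLimit_apply]
    fin_cases j <;> simp at hj ⊢
  convert hm using 1
  rw [if_pos rfl, h4, h3, h2, map_zero, mul_zero, add_zero, sub_add_cancel, oddPair,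
    scalar_eq_smul, scalar_eq_smul, mul_smul_comm, mul_smul_comm, mul_smul_comm, mul_one, mul_one]

theorem hasLimit_minor (h : Generic z) {i j : Fin 5} {i' j' : Fin 4} (hi : i = i'.castSucc)
    (hj : j = j'.castSucc) : HasLimit (modeValue z) (parModel.lift (minor i j))
      (scalar (entryValue z i' 0 * entryValue z j' 1 - entryValue z i' 1 * entryValue z j' 0)) := by
  rw [minor, map_sub, map_smul, map_mul, map_mul, map_sub, map_mul, map_mul]
  exact ((hasLimit_entry h i' hi 0).mul (hasLimit_entry h j' hj 1)).sub
    (((hasLimit_entry h i' hi 1).mul (hasLimit_entry h j' hj 0)).qpow_smul _)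

theorem hasLimit_minor_odd (h : Generic z) {i : Fin 5} {i' : Fin 4} (hi : i = i'.castSucc) :
    HasLimit (modeValue z) (parModel.lift (minor i 4))
      (oddPair (entryValue z i' 0 * entryValue z 3 1 - entryValue z i' 1 * entryValue z 3 0)
        (entryValue z i' 0 * (entryValue z 3 1 - entryValue z 2 1) -
          entryValue z i' 1 * (entryValue z 3 0 - entryValue z 2 0))) := by
  rw [minor, map_sub, map_smul, map_mul, map_mul, ← oddPair_sub, ← scalar_mul_oddPair,
    ← scalar_mul_oddPair]
  exact ((hasLimit_entry h i' hi 0).mul (hasLimit_entry_odd h (by decide))).sub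
    (((hasLimit_entry h i' hi 1).mul (hasLimit_entry_odd h (by decide))).qpow_smul _)

/-- The limit of `D₁₂` is a nonzero scalar; evaluating it on `D₁₂⁻¹ f` and dividing by that scalar
gives the limit of `D₁₂⁻¹ f`. -/
theorem hasLimit_invMinor (h : Generic z) : HasLimit (modeValue z) (parModel.lift invMinor)
    (scalar (z 4 * z 7 - z 5 * z 6)⁻¹) := by
  intro f
  have key := hasLimit_minor h (i := 0) (j := 1) (i' := 0) (j' := 1) rfl rfl
    (parModel.lift invMinor f)
  rw [← Module.End.mul_apply, ← map_mul, minor_mul_invMinor, map_one, Module.End.one_apply,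
    scalar_apply] at key
  have hd : entryValue z 0 0 * entryValue z 1 1 - entryValue z 0 1 * entryValue z 1 0 =
    z 4 * z 7 - z 5 * z 6 := rfl
  rw [key, scalar_apply, smul_smul, hd, inv_mul_cancel₀ h.hx, one_smul]

/-- Cramer's rule: row `r'` is `c` times the first row plus `d` times the second, and the quotients
of minors recover `c` and `d`. The other `lower` limits follow in the same way. -/
theorem hasLimit_lower2 (h : Generic z) {r : Fin 5} {r' : Fin 4} (hr : r = r'.castSucc) {c d : K}
    (h0 : entryValue z r' 0 = c * z 4 + d * z 6) (h1 : entryValue z r' 1 = c * z 5 + d * z 7) :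
    HasLimit (modeValue z) (parModel.lift (lower2 r)) (scalar d) := by
  rw [lower2, map_mul]
  convert (hasLimit_minor h (i := 0) (i' := 0) rfl hr).mul (hasLimit_invMinor h) using 1
  rw [← map_mul, h0, h1, show entryValue z 0 0 = z 4 from rfl, show entryValue z 0 1 = z 5 from rfl]
  congr 1
  rw [eq_mul_inv_iff_mul_eq₀ h.hx]
  ring

theorem hasLimit_lower1 (h : Generic z) {r : Fin 5} {r' : Fin 4} (hr : r = r'.castSucc) {c d : K}
    (h0 : entryValue z r' 0 = c * z 4 + d * z 6) (h1 : entryValue z r' 1 = c * z 5 + d * z 7) :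
    HasLimit (modeValue z) (parModel.lift (lower1 r)) (scalar c) := by
  rw [lower1, map_neg, map_smul, map_mul]
  convert (((hasLimit_minor h (i := 1) (i' := 1) rfl hr).mul
    (hasLimit_invMinor h)).qpow_smul (-1)).neg using 1
  rw [← map_mul, ← map_neg, h0, h1, show entryValue z 1 0 = z 6 from rfl,
    show entryValue z 1 1 = z 7 from rfl]
  congr 1
  rw [← neg_mul, eq_mul_inv_iff_mul_eq₀ h.hx]
  ring

theorem hasLimit_lower2_odd (h : Generic z) : HasLimit (modeValue z) (parModel.lift (lower2 4))
    (oddPair (z 2) (z 2 - z 0)) := by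
  rw [lower2, map_mul]
  convert (hasLimit_minor_odd h (i := 0) (i' := 0) rfl).mul (hasLimit_invMinor h) using 1
  rw [oddPair_mul_scalar]
  congr 1 <;> rw [eq_mul_inv_iff_mul_eq₀ h.hx] <;> simp [entryValue] <;> ring

theorem hasLimit_lower1_odd (h : Generic z) : HasLimit (modeValue z) (parModel.lift (lower1 4))
    (oddPair (z 3) (z 3 - z 1)) := by
  rw [lower1, map_neg, map_smul, map_mul]
  convert (((hasLimit_minor_odd h (i := 1) (i' := 1) rfl).mul
    (hasLimit_invMinor h)).qpow_smul (-1)).neg using 1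
  rw [oddPair_mul_scalar, oddPair_neg]
  congr 1 <;> rw [← neg_mul, eq_mul_inv_iff_mul_eq₀ h.hx] <;> simp [entryValue] <;> ring

/-- The limits of the generators of the quantum Poincaré group. -/
def genLimit (z : Fin 12 → K) : Fin 14 → Module.End K ((Fin 2 → ZMod 2) → K) :=
  Fin.cons (oddPair (z 2) (z 2 - z 0)) (Fin.cons (oddPair (z 3) (z 3 - z 1)) fun k => scalar (z k))

theorem hasLimit_gen (h : Generic z) (i : Fin 14) :
    HasLimit (modeValue z) (parModel.lift (gen i)) (genLimit z i) := by
  fin_cases i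
  · exact hasLimit_lower2_odd h
  · exact hasLimit_lower1_odd h
  · exact hasLimit_lower2 h (r' := 2) rfl (c := z 1) rfl rfl
  · exact hasLimit_lower1 h (r' := 2) rfl (d := z 0) rfl rfl
  · exact hasLimit_lower2 h (r' := 3) rfl (c := z 3) rfl rfl
  · exact hasLimit_lower1 h (r' := 3) rfl (d := z 2) rfl rfl
  · exact hasLimit_entry h 0 rfl 0
  · exact hasLimit_entry h 0 rfl 1
  · exact hasLimit_entry h 1 rfl 0
  · exact hasLimit_entry h 1 rfl 1
  · exact hasLimit_entry h 2 rfl 2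
  · exact hasLimit_entry h 2 rfl 3
  · exact hasLimit_entry h 3 rfl 2
  · exact hasLimit_entry h 3 rfl 3

theorem hasLimit_monomial (h : Generic z) (e : Exponent) :
    HasLimit (modeValue z) (parModel.lift (monomial e))
      (oddPair (z 2) (z 2 - z 0) ^ e.1 0 * (oddPair (z 3) (z 3 - z 1) ^ e.1 1 *
        scalar (∏ k : Fin 12, z k ^ e.1 k.succ.succ))) := by
  have h1 : parModel.lift (monomial e) =
      (List.ofFn fun i => parModel.lift (gen i) ^ e.1 i).prod := by
    rw [monomial, map_list_prod, List.map_ofFn]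
    simp only [Function.comp_def, map_pow]
  rw [h1]
  convert hasLimit_list_prod fun i => (hasLimit_gen h i).pow (e.1 i) using 1
  rw [List.ofFn_succ, List.ofFn_succ, List.prod_cons, List.prod_cons, ← List.prod_ofFn,
    map_list_prod, List.map_ofFn]
  simp only [Function.comp_def, map_pow]
  rfl

end Limits

end
end QuantumPoincare

namespace QuantumPoincare

noncomputable section

/-! ### Independence in the limit -/

section Independence

set_option linter.unusedSectionVars false

variable {K : Type*} [Field K] [Algebra ℂ K] {z : Fin 12 → K}

/-- The limit of the vacuum. -/
def vacuum (K : Type*) [Field K] : (Fin 2 → ZMod 2) → K := Pi.single 0 1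

theorem limit_vacuum (u : Fin 13 → K) : limit u (Finsupp.single 0 1) = vacuum K := by
  rw [limit_single]
  simp [vacuum]

theorem oddPair_apply (c d : K) (φ : (Fin 2 → ZMod 2) → K) (S : Fin 2 → ZMod 2) :
    oddPair c d φ S = c * (if S 0 = 1 then φ (S - Pi.single 0 1) else 0) +
      d * (if S 0 = 0 then (if S 1 = 1 then φ (S - Pi.single 1 1) else 0)
        else -(if S 1 = 1 then φ (S - Pi.single 1 1) else 0)) := rfl

/-- The products of the limits of the two odd generators, applied to the vacuum. -/
def oddVector (z : Fin 12 → K) (p : Fin 2 × Fin 2) : (Fin 2 → ZMod 2) → K :=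
  (oddPair (z 2) (z 2 - z 0) ^ (p.1 : ℕ)) ((oddPair (z 3) (z 3 - z 1) ^ (p.2 : ℕ)) (vacuum K))

/-- The coefficient determinant of the two combinations of odd variables is `z₂(z₃ - z₁) - z₃(z₂ -
z₀) = z₀z₃ - z₂z₁`. It is also the coefficient of their product applied to the vacuum. -/
theorem linearIndependent_oddVector (h : z 0 * z 3 - z 2 * z 1 ≠ 0) :
    LinearIndependent K (oddVector z) := by
  rw [Fintype.linearIndependent_iff]
  intro g hg
  rw [Fintype.sum_prod_type, Fin.sum_univ_two, Fin.sum_univ_two, Fin.sum_univ_two] at hg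
  have e0 := congrFun hg ![0, 0]
  have e1 := congrFun hg ![1, 0]
  have e2 := congrFun hg ![0, 1]
  have e3 := congrFun hg ![1, 1]
  have s0 : (Pi.single 0 1 : Fin 2 → ZMod 2) = ![1, 0] := by decide
  have s1 : (Pi.single 1 1 : Fin 2 → ZMod 2) = ![0, 1] := by decide
  simp [oddVector, oddPair_apply, vacuum, Pi.single_apply, funext_iff, s0, s1] at e0 e1 e2 e3
  have h' : g (0, 1) * (z 0 * z 3 - z 2 * z 1) = 0 := by
    linear_combination (z 0 - z 2) * e1 + z 2 * e2
  have h'' : g (1, 0) * (z 0 * z 3 - z 2 * z 1) = 0 := by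
    linear_combination (z 3 - z 1) * e1 - z 3 * e2
  have h''' : g (1, 1) * (z 0 * z 3 - z 2 * z 1) = 0 := by
    rcases e3 with e3 | e3
    · rw [e3, zero_mul]
    · linear_combination g (1, 1) * e3
  intro p
  fin_cases p
  exacts [e0, (mul_eq_zero.1 h').resolve_right h, (mul_eq_zero.1 h'').resolve_right h,
    (mul_eq_zero.1 h''').resolve_right h]

theorem limit_lift_monomial (h : Generic z) (e : Exponent) :
    limit (modeValue z) (parModel.lift (monomial e) (Finsupp.single 0 1)) =
      (∏ k : Fin 12, z k ^ e.1 k.succ.succ) •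
        oddVector z (⟨e.1 0, Nat.lt_succ_of_le e.2.1⟩, ⟨e.1 1, Nat.lt_succ_of_le e.2.2⟩) := by
  rw [hasLimit_monomial h e, limit_vacuum, Module.End.mul_apply, Module.End.mul_apply, scalar_apply,
    map_smul, map_smul, oddVector]

/-- The field of rational functions in twelve variables. -/
abbrev RatFun : Type := FractionRing (MvPolynomial (Fin 12) ℂ)

/-- The variables as rational functions. -/
def ratVar (k : Fin 12) : RatFun := algebraMap (MvPolynomial (Fin 12) ℂ) RatFun (MvPolynomial.X k)

theorem algebraMap_ne_zero_of_eval {p : MvPolynomial (Fin 12) ℂ}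
    (h : MvPolynomial.eval ![1, 1, 3, 2, 1, 1, 0, 1, 1, 1, 0, 1] p ≠ 0) :
    algebraMap (MvPolynomial (Fin 12) ℂ) RatFun p ≠ 0 := by
  rw [Ne, map_eq_zero_iff _ (IsFractionRing.injective _ _)]
  rintro rfl
  exact h (map_zero _)

/-- Each condition is the nonvanishing of a polynomial, and the point in
`algebraMap_ne_zero_of_eval` is one at which none of these polynomials vanishes. -/
theorem generic_ratVar : Generic ratVar := by
  constructor <;> simp only [ratVar, ← map_mul, ← map_sub, ← map_add] <;>
    refine algebraMap_ne_zero_of_eval ?_ <;> simp <;> norm_num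

theorem linearIndependent_prod_ratVar :
    LinearIndependent ℂ fun n : Fin 12 → ℕ => ∏ k, ratVar k ^ n k := by
  have he : (fun n : Fin 12 → ℕ => ∏ k, ratVar k ^ n k) =
      ((IsScalarTower.toAlgHom ℂ (MvPolynomial (Fin 12) ℂ) RatFun).toLinearMap ∘
        MvPolynomial.basisMonomials (Fin 12) ℂ) ∘
          (Finsupp.equivFunOnFinite (α := Fin 12) (M := ℕ)).symm := by
    funext n
    simp [ratVar, MvPolynomial.monomial_eq, Finsupp.prod_fintype]
  rw [he]
  exact ((MvPolynomial.basisMonomials (Fin 12) ℂ).linearIndependent.map'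
    (IsScalarTower.toAlgHom ℂ (MvPolynomial (Fin 12) ℂ) RatFun).toLinearMap
    (LinearMap.ker_eq_bot.2 (IsFractionRing.injective _ _))).comp
    (Finsupp.equivFunOnFinite (α := Fin 12) (M := ℕ)).symm (Equiv.injective _)

/-- Independence in two layers: the four odd vectors are independent over the field of rational
functions, and the monomials in the variables are independent over `ℂ` inside that field. -/
theorem linearIndependent_limit : LinearIndependent ℂ fun e : Exponent =>
    limit (modeValue ratVar) (parModel.lift (monomial e) (Finsupp.single 0 1)) := by
  simp only [limit_lift_monomial generic_ratVar]
  refine (linearIndependent_smul linearIndependent_prod_ratVar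
    (linearIndependent_oddVector generic_ratVar.ht)).comp
    (fun e : Exponent => (fun k : Fin 12 => e.1 k.succ.succ,
      ((⟨e.1 0, Nat.lt_succ_of_le e.2.1⟩ : Fin 2), (⟨e.1 1, Nat.lt_succ_of_le e.2.2⟩ : Fin 2)))) ?_
  intro e e' h
  simp only [Prod.mk.injEq, Fin.mk.injEq] at h
  exact Subtype.ext (funext (Fin.cases h.2.1 (Fin.cases h.2.2 (congrFun h.1))))

/-! ### Descent from the specialization -/

theorem sub_one_dvd_sub_atOne (x : Cq) :
    (LaurentPolynomial.T 1 - 1 : Cq) ∣ x - LaurentPolynomial.C (atOne x) := by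
  induction x using LaurentPolynomial.induction_on' with
  | add p q hp hq =>
    rw [map_add, map_add, add_sub_add_comm]
    exact dvd_add hp hq
  | C_mul_T n r =>
    have h1 : atOne (LaurentPolynomial.C r * LaurentPolynomial.T n) = r := by simp [atOne]
    rw [h1, ← mul_sub_one]
    refine Dvd.dvd.mul_left ?_ _
    have hn : ∀ m : ℕ, (LaurentPolynomial.T 1 - 1 : Cq) ∣ LaurentPolynomial.T (m : ℤ) - 1 := by
      intro m
      have := sub_one_dvd_pow_sub_one (LaurentPolynomial.T 1 : Cq) m
      rwa [LaurentPolynomial.T_pow, mul_one] at this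
    obtain ⟨m, rfl | rfl⟩ := n.eq_nat_or_neg
    · exact hn m
    · have : (LaurentPolynomial.T (-(m : ℤ)) - 1 : Cq) =
          -LaurentPolynomial.T (-(m : ℤ)) * (LaurentPolynomial.T (m : ℤ) - 1) := by
        rw [mul_sub, neg_mul, ← LaurentPolynomial.T_add, neg_add_cancel, LaurentPolynomial.T_zero]
        ring
      rw [this]
      exact (hn m).mul_left _

theorem atOne_sub_one : atOne (LaurentPolynomial.T 1 - 1) = 0 := by
  simp [atOne]

theorem sub_one_ne_zero : (LaurentPolynomial.T 1 - 1 : Cq) ≠ 0 := by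
  intro h
  have := congrArg (fun p : Cq => LaurentPolynomial.eval₂ (RingHom.id ℂ) (Units.mk0 2 two_ne_zero) p) h
  norm_num at this

theorem isNoetherianRing_Cq : IsNoetherianRing Cq :=
  IsLocalization.isNoetherianRing (Submonoid.powers (Polynomial.X : Polynomial ℂ)) _ inferInstance

theorem eq_zero_of_forall_pow_dvd {x : Cq} (h : ∀ n, (LaurentPolynomial.T 1 - 1 : Cq) ^ n ∣ x) :
    x = 0 := by
  have := isNoetherianRing_Cq
  by_contra hx
  have hu : ¬ IsUnit (LaurentPolynomial.T 1 - 1 : Cq) := fun hu =>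
    not_isUnit_zero (atOne_sub_one ▸ hu.map atOne)
  obtain ⟨n, hn⟩ := FiniteMultiplicity.of_not_isUnit hu hx
  exact hn (h _)

/-- Coefficients that vanish at `q = 1` are divisible by `q - 1`. Torsion-freeness turns the
quotients into a relation again, so the divisibility iterates to every power. -/
theorem linearIndependent_of_specialization {ι M : Type*} [AddCommGroup M] [Module Cq M]
    [Module.IsTorsionFree Cq M] {v : ι → M}
    (h : ∀ f : ι →₀ Cq, Finsupp.linearCombination Cq v f = 0 → ∀ i, atOne (f i) = 0) :
    LinearIndependent Cq v := by
  have key : ∀ (n : ℕ) (f : ι →₀ Cq), Finsupp.linearCombination Cq v f = 0 →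
      ∀ i, (LaurentPolynomial.T 1 - 1 : Cq) ^ n ∣ f i := by
    intro n
    induction n with
    | zero => simp
    | succ n ih =>
      intro f hf i
      have hdvd : ∀ i, (LaurentPolynomial.T 1 - 1 : Cq) ∣ f i := fun i => by
        simpa [h f hf i] using sub_one_dvd_sub_atOne (f i)
      choose g hg using hdvd
      let g' : ι →₀ Cq := Finsupp.onFinset f.support g fun i hi => by
        rw [Finsupp.mem_support_iff, hg]
        exact mul_ne_zero sub_one_ne_zero hi
      have hfg : f = (LaurentPolynomial.T 1 - 1 : Cq) • g' := Finsupp.ext hg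
      rw [hfg, map_smul, smul_eq_zero_iff_right sub_one_ne_zero] at hf
      rw [hg, pow_succ']
      exact mul_dvd_mul_left _ (ih g' hf i)
  rw [linearIndependent_iff]
  exact fun f hf => Finsupp.ext fun i => eq_zero_of_forall_pow_dvd fun n => key n f hf i

theorem linearIndependent_lift_monomial : LinearIndependent Cq fun e : Exponent =>
    parModel.lift (monomial e) (Finsupp.single 0 1 : Fock) := by
  apply linearIndependent_of_specialization
  intro f hf i
  have h := linearIndependent_iff.1 linearIndependent_limit (f.mapRange atOne (map_zero _)) ?_
  · simpa using DFunLike.congr_fun h i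
  · have := congrArg (limit (modeValue ratVar)) hf
    rw [Finsupp.linearCombination_apply, map_finsuppSum, map_zero] at this
    simp only [limit_smul] at this
    rw [Finsupp.linearCombination_apply, Finsupp.sum_mapRange_index (by simp)]
    simpa [algebraMap_smul] using this

/-- Acting on the vacuum is a linear map from the parabolic to `Fock`, and independence of the
images suffices. -/
theorem linearIndependent_monomial : LinearIndependent Cq monomial :=
  LinearIndependent.of_comp
    ((LinearMap.applyₗ (Finsupp.single 0 1 : Fock)).comp parModel.lift.toLinearMap)
    linearIndependent_lift_monomial

/-- The basis of ordered monomials. -/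
def monomialBasis : Module.Basis Exponent Cq OqP :=
  (Module.Basis.span linearIndependent_monomial).map
    (LinearEquiv.ofEq _ (Subalgebra.toSubmodule OqP) span_monomial)

theorem monomialBasis_apply (e : Exponent) : (monomialBasis e : OPar) = monomial e := by
  rw [monomialBasis, Module.Basis.map_apply, LinearEquiv.coe_ofEq_apply]
  exact congrArg Subtype.val (Module.Basis.span_apply _ _)

end Independence

end
end QuantumPoincare

theorem theoremA2 :
    IsUnit (QuantumPoincare.minor 0 1) ∧
    ∃ b : Module.Basis QuantumPoincare.Exponent QuantumPoincare.Cq QuantumPoincare.OqP,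
      ∀ e : QuantumPoincare.Exponent,
        (b e : QuantumPoincare.OPar) = QuantumPoincare.monomial e := by
  exact ⟨QuantumPoincare.isUnit_minor, QuantumPoincare.monomialBasis,
    QuantumPoincare.monomialBasis_apply⟩
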